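/- **Theorem 1.1.** Let $X=(X,d,\mu)$ be a separable, locally compact metric space with a Borel measure $\mu$, admitting a strong measured differentiable structure, and let $(Y,\pi)$ be a chart, $\pi\colon Y\to\mathbb E$, with $\mathbb E$ a Euclidean space. Let $$\omega=\sum_{s\in S}\beta_s\,dg_s^1\wedge\dots\wedge dg_s^k ,$$ where $S$ is finite, the $\beta_s$ are bounded Borel functions on $X$ with compact support, and the $g_s^i$ are locally Lipschitz functions on $X$. Let $Y_\omega\subseteq Y$ be the set of all $y\in Y$ such that every $g_s^i$ is differentiable at $y$ and $$\sum_{s\in S}\beta_s(y)\,d_\pi g^1_{s,y}\wedge\dots\wedge d_\pi g^k_{s,y}=0\quad\text{in }\textstyle\bigwedge^k\mathbb E^*.$$ Then every metric $k$-current $T$ on $X$ of locally finite mass that is concentrated on $Y_\omega$ satisfies $$T(\omega)=\sum_{s\in S}T(\beta_s\,dg_s^1\wedge\dots\wedge dg_s^k)=0 .$$ *Definitions.* - *Differentials.* For a Lipschitz map $\pi\colon Y\to\mathbb E$, $f\colon X\to\mathbb R$ is *differentiable* at $y\in Y$ if there is a unique $d_\pi f_y\in\mathbb E^*$ with $f(x)=f(y)+\langle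 d_\pi f_y,\pi(x)-\pi(y)\rangle+o(d(x,y))$ as $x\to y$ in $Y$. The pair $(Y,\pi)$, $Y\subseteq X$, is a *chart* if for every Lipschitz $f\colon X\to\mathbb R$ there is $Y_f\subseteq Y$ with $\mu(Y\setminus Y_f)=0$ on which there is a unique measurable map $y\mapsto d_\pi f_y\in\mathbb E^*$ with this expansion at every $y\in Y_f$. $X$ *admits a strong measured differentiable structure* if it is a countable union of charts. - *Currents.* Let $\mathrm{Lip}_c(X)$ and $\mathrm{Lip}_{loc}(X)$ be the spaces of Lipschitz functions with compact support and of locally Lipschitz functions. A *metric $k$-current* is a map $T\colon \mathrm{Lip}_c(X)\times \mathrm{Lip}_{loc}(X)^k\to\mathbb R$, written $(f,g^1,\dots,g^k)\mapsto T(f\,dg^1\wedge\dots\wedge dg^k)$, that is linear in each argument; is sequentially continuous, for pointwise convergence with, in $\mathrm{Lip}_c(X)$, a common Lipschitz constant and a common compact set containing the supports and, in $\mathrm{Lip}_{loc}(X)$, a common Lipschitz constant on each compact set; and vanishes whenever some $g^i$ is constant on $\operatorname{supp} f$. - *Mass.* For open $U$, $\|T\|(U)$ is the supremum of $\sum_j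 T(f_j\,dg_j^1\wedge\dots\wedge dg_j^k)$ over all finite families with $\operatorname{supp} f_j\subseteq U$, each $g_j^i$ $1$-Lipschitz on $\operatorname{supp} f_j$, and $\sum_j|f_j|\le1$; for arbitrary $A$, $\|T\|(A)=\inf\{\|T\|(U): U\supseteq A\text{ open}\}$. This is a Borel regular outer measure. $T$ has *locally finite mass* if $\|T\|(A)<\infty$ whenever $\overline A$ is compact, and is *concentrated* on $A$ if $\|T\|(X\setminus A)=0$. - *Extension.* For $\beta$ bounded Borel with compact support, $T(\beta\,dg^1\wedge\dots\wedge dg^k)$ is the limit of $T(f_n\,dg^1\wedge\dots\wedge dg^k)$ for any $f_n\in\mathrm{Lip}_c(X)$ with supports in a common compact set and $f_n\to\beta$ in $L^1(X,\|T\|)$. That such sequences exist, and that the limit exists and does not depend on the sequence, is part of the assertion. -/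

import Mathlib

open Filter Topology MeasureTheory
open scoped NNReal ENNReal

/-! ## Spaces of Lipschitz functions -/

/-- `Lip_c(X)`: the real vector space of Lipschitz functions with compact support. -/
def LipC (X : Type*) [MetricSpace X] : Submodule ℝ (X → ℝ) where
  carrier := {f | (∃ L : ℝ≥0, LipschitzWith L f) ∧ HasCompactSupport f}
  zero_mem' := ⟨⟨0, LipschitzWith.const 0⟩, HasCompactSupport.zero⟩
  add_mem' := by
    rintro f g ⟨⟨L, hL⟩, hf⟩ ⟨⟨M, hM⟩, hg⟩
    exact ⟨⟨L + M, hL.add hM⟩, hf.add hg⟩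
  smul_mem' := by
    rintro c f ⟨⟨L, hL⟩, hf⟩
    exact ⟨⟨_, (lipschitzWith_smul c).comp hL⟩, hf.smul_left (f := fun _ => c)⟩

/-- `Lip_loc(X)`: the real vector space of locally Lipschitz functions. -/
def LipLoc (X : Type*) [MetricSpace X] : Submodule ℝ (X → ℝ) where
  carrier := {g | LocallyLipschitz g}
  zero_mem' := LocallyLipschitz.const 0
  add_mem' := fun hf hg => hf.add hg
  smul_mem' := by
    intro c f hf x
    obtain ⟨K, t, ht, h⟩ := hf x
    exact ⟨_, t, ht, (lipschitzWith_smul c).comp_lipschitzOnWith h⟩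

/-- Convergence of sequences in `Lip_c(X)`: pointwise convergence, with a common Lipschitz
constant and a common compact set containing all supports. -/
def LipCConverges {X : Type*} [MetricSpace X] (f : ℕ → LipC X) (f₀ : LipC X) : Prop :=
  (∀ x, Tendsto (fun n => (f n : X → ℝ) x) atTop (𝓝 ((f₀ : X → ℝ) x))) ∧
  (∃ L : ℝ≥0, LipschitzWith L (f₀ : X → ℝ) ∧ ∀ n, LipschitzWith L (f n : X → ℝ)) ∧
  ∃ K : Set X, IsCompact K ∧ tsupport (f₀ : X → ℝ) ⊆ K ∧ ∀ n, tsupport (f n : X → ℝ) ⊆ K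

/-- Convergence of sequences in `Lip_loc(X)`: pointwise convergence, with a common Lipschitz
constant on each compact set. -/
def LipLocConverges {X : Type*} [MetricSpace X] (g : ℕ → LipLoc X) (g₀ : LipLoc X) : Prop :=
  (∀ x, Tendsto (fun n => (g n : X → ℝ) x) atTop (𝓝 ((g₀ : X → ℝ) x))) ∧
  ∀ K : Set X, IsCompact K →
    ∃ L : ℝ≥0, LipschitzOnWith L (g₀ : X → ℝ) K ∧ ∀ n, LipschitzOnWith L (g n : X → ℝ) K

/-! ## Metric currents -/

/-- Functionals `T(f, g¹, …, gᵏ)` on `Lip_c(X) × Lip_loc(X)ᵏ` that are linear in each argument. -/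
abbrev FormFunctional (k : ℕ) (X : Type*) [MetricSpace X] :=
  LipC X →ₗ[ℝ] MultilinearMap ℝ (fun _ : Fin k => LipLoc X) ℝ

/-- A metric `k`-current on `X`: a functional on `Lip_c(X) × Lip_loc(X)ᵏ` that is linear in each
argument, sequentially continuous, and local. -/
structure MetricCurrent (k : ℕ) (X : Type*) [MetricSpace X] where
  /-- the value of the current on `f dg¹ ∧ … ∧ dgᵏ` -/
  toFun : FormFunctional k X
  continuity : ∀ (f : ℕ → LipC X) (f₀ : LipC X) (g : ℕ → Fin k → LipLoc X) (g₀ : Fin k → LipLoc X),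
    LipCConverges f f₀ → (∀ i, LipLocConverges (fun n => g n i) (g₀ i)) →
    Tendsto (fun n => toFun (f n) (g n)) atTop (𝓝 (toFun f₀ g₀))
  locality : ∀ (f : LipC X) (g : Fin k → LipLoc X) (i : Fin k) (c : ℝ),
    (∀ x ∈ tsupport (f : X → ℝ), (g i : X → ℝ) x = c) → toFun f g = 0

/-! ## The mass -/

/-- A finite family of simple forms `f_s dg_s¹ ∧ … ∧ dg_sᵏ` with the support of each `f_s` in `U`,
each `g_sⁱ` being `1`-Lipschitz on the support of `f_s`, and `∑ |f_s| ≤ 1` everywhere. The forms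
`∑ f_s dg_s¹ ∧ … ∧ dg_sᵏ` so obtained are those of comass at most `1` in `U` (up to scaling by
factors arbitrarily close to `1`). -/
def IsUnitComassFamily {k : ℕ} {X : Type*} [MetricSpace X] (U : Set X) {n : ℕ}
    (f : Fin n → LipC X) (g : Fin n → Fin k → LipLoc X) : Prop :=
  (∀ s, tsupport (f s : X → ℝ) ⊆ U) ∧
  (∀ s i, LipschitzOnWith 1 (g s i : X → ℝ) (tsupport (f s : X → ℝ))) ∧
  ∀ x, ∑ s, |(f s : X → ℝ) x| ≤ 1

/-- The mass of `T` on an open set `U`: the supremum of `T(ω)` over the forms `ω` supported in `U`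
of comass at most `1`. -/
noncomputable def openMass {k : ℕ} {X : Type*} [MetricSpace X] (T : FormFunctional k X)
    (U : Set X) : ℝ≥0∞ :=
  ⨆ (n : ℕ) (f : Fin n → LipC X) (g : Fin n → Fin k → LipLoc X) (_ : IsUnitComassFamily U f g),
    ENNReal.ofReal (∑ s, T (f s) (g s))

section MassLemmas

variable {k : ℕ} {X : Type*} [MetricSpace X]

theorem le_openMass (T : FormFunctional k X) {U : Set X} {n : ℕ} {f : Fin n → LipC X}
    {g : Fin n → Fin k → LipLoc X} (h : IsUnitComassFamily U f g) :
    ENNReal.ofReal (∑ s, T (f s) (g s)) ≤ openMass T U :=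
  le_iSup_of_le n (le_iSup_of_le f (le_iSup_of_le g (le_iSup_of_le h le_rfl)))

theorem openMass_le (T : FormFunctional k X) {U : Set X} {c : ℝ≥0∞}
    (H : ∀ (n : ℕ) (f : Fin n → LipC X) (g : Fin n → Fin k → LipLoc X),
      IsUnitComassFamily U f g → ENNReal.ofReal (∑ s, T (f s) (g s)) ≤ c) : openMass T U ≤ c :=
  iSup_le fun n => iSup_le fun f => iSup_le fun g => iSup_le fun h => H n f g h

theorem openMass_mono (T : FormFunctional k X) {U V : Set X} (h : U ⊆ V) :
    openMass T U ≤ openMass T V :=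
  openMass_le T fun _ _ _ hf => le_openMass T ⟨fun s => (hf.1 s).trans h, hf.2⟩

theorem openMass_empty (T : FormFunctional k X) : openMass T ∅ = 0 := by
  refine le_antisymm (openMass_le T fun n f g h => ?_) zero_le
  have h0 : ∀ s, f s = 0 := by
    intro s
    apply Subtype.ext
    exact tsupport_eq_empty_iff.1 (Set.subset_empty_iff.1 (h.1 s))
  simp [h0]

/-- Superadditivity of the mass on disjoint sets. -/
theorem openMass_add_le (T : FormFunctional k X) {U V W : Set X} (hU : U ⊆ W) (hV : V ⊆ W)
    (hd : Disjoint U V) : openMass T U + openMass T V ≤ openMass T W := by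
  have key : ∀ (n : ℕ) (f : Fin n → LipC X) (g : Fin n → Fin k → LipLoc X),
      IsUnitComassFamily U f g → ∀ (m : ℕ) (f' : Fin m → LipC X) (g' : Fin m → Fin k → LipLoc X),
      IsUnitComassFamily V f' g' →
      ENNReal.ofReal (∑ s, T (f s) (g s)) + ENNReal.ofReal (∑ s, T (f' s) (g' s))
        ≤ openMass T W := by
    intro n f g h m f' g' h'
    have hUm := (le_openMass T h).trans (openMass_mono T hU)
    have hVm := (le_openMass T h').trans (openMass_mono T hV)
    rcases le_total (∑ s, T (f s) (g s)) 0 with h0 | h0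
    · rw [ENNReal.ofReal_of_nonpos h0, zero_add]; exact hVm
    rcases le_total (∑ s, T (f' s) (g' s)) 0 with h1 | h1
    · rw [ENNReal.ofReal_of_nonpos h1, add_zero]; exact hUm
    rw [← ENNReal.ofReal_add h0 h1]
    have hfam : IsUnitComassFamily W (Fin.append f f') (Fin.append g g') := by
      refine ⟨?_, ?_, ?_⟩
      · refine Fin.addCases (fun s => ?_) (fun s => ?_)
        · rw [Fin.append_left]; exact (h.1 s).trans hU
        · rw [Fin.append_right]; exact (h'.1 s).trans hV
      · refine Fin.addCases (fun s => ?_) (fun s => ?_)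
        · rw [Fin.append_left, Fin.append_left]; exact h.2.1 s
        · rw [Fin.append_right, Fin.append_right]; exact h'.2.1 s
      · intro x
        rw [Fin.sum_univ_add]
        simp only [Fin.append_left, Fin.append_right]
        by_cases hx : x ∈ U
        · have hx' : x ∉ V := fun hv => Set.disjoint_left.1 hd hx hv
          have : ∀ s, (f' s : X → ℝ) x = 0 := fun s =>
            image_eq_zero_of_notMem_tsupport fun hs => hx' (h'.1 s hs)
          simpa [this] using h.2.2 x
        · have : ∀ s, (f s : X → ℝ) x = 0 := fun s =>
            image_eq_zero_of_notMem_tsupport fun hs => hx (h.1 s hs)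
          simpa [this] using h'.2.2 x
    have := le_openMass T hfam
    rw [Fin.sum_univ_add] at this
    simpa only [Fin.append_left, Fin.append_right] using this
  by_cases htop : openMass T W = ⊤
  · rw [htop]; exact le_top
  have hVfin : openMass T V ≠ ⊤ := ne_top_of_le_ne_top htop (openMass_mono T hV)
  rw [← ENNReal.le_sub_iff_add_le_right hVfin (openMass_mono T hV)]
  refine openMass_le T fun n f g h => ?_
  have hfin : ENNReal.ofReal (∑ s, T (f s) (g s)) ≠ ⊤ := ENNReal.ofReal_ne_top
  rw [ENNReal.le_sub_iff_add_le_right hVfin (openMass_mono T hV), add_comm,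
    ← ENNReal.le_sub_iff_add_le_right hfin ((le_openMass T h).trans (openMass_mono T hU))]
  refine openMass_le T fun m f' g' h' => ?_
  rw [ENNReal.le_sub_iff_add_le_right hfin ((le_openMass T h).trans (openMass_mono T hU)), add_comm]
  exact key n f g h m f' g' h'

/-- The product of a compactly supported Lipschitz function with a Lipschitz function with values
in `[0, 1]`. -/
theorem mul_mem_LipC {φ : X → ℝ} {L : ℝ≥0} (hφ : LipschitzWith L φ) (h0 : ∀ x, 0 ≤ φ x)
    (h1 : ∀ x, φ x ≤ 1) (f : LipC X) : (fun x => φ x * (f : X → ℝ) x) ∈ LipC X := by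
  obtain ⟨f, ⟨M, hM⟩, hf⟩ := f
  refine ⟨?_, hf.mul_left⟩
  obtain ⟨C, hC⟩ := hM.continuous.bounded_above_of_compact_support hf
  refine ⟨(M : ℝ≥0) + C.toNNReal * L, LipschitzWith.of_dist_le_mul fun x y => ?_⟩
  have e1 : |f x - f y| ≤ M * dist x y := by simpa [Real.dist_eq] using hM.dist_le_mul x y
  have e2 : |φ x - φ y| ≤ L * dist x y := by simpa [Real.dist_eq] using hφ.dist_le_mul x y
  have e3 : |f y| ≤ C.toNNReal := (hC y).trans (Real.le_coe_toNNReal C)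
  have e4 : |φ x| ≤ 1 := abs_le.2 ⟨by linarith [h0 x], h1 x⟩
  have e5 : φ x * f x - φ y * f y = φ x * (f x - f y) + (φ x - φ y) * f y := by ring
  rw [Real.dist_eq]
  push_cast
  change |φ x * f x - φ y * f y| ≤ _
  rw [e5]
  refine (abs_add_le _ _).trans ?_
  rw [abs_mul, abs_mul]
  have i1 : |φ x| * |f x - f y| ≤ 1 * (M * dist x y) :=
    mul_le_mul e4 e1 (abs_nonneg _) zero_le_one
  have i2 : |φ x - φ y| * |f y| ≤ (L * dist x y) * C.toNNReal :=
    mul_le_mul e2 e3 (abs_nonneg _) (by positivity)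
  linarith

/-- A Lipschitz cutoff splitting a compact subset of `U ∪ V`. -/
theorem exists_lipschitz_cutoff {K U V : Set X} (hK : IsCompact K) (hU : IsOpen U) (hV : IsOpen V)
    (hKUV : K ⊆ U ∪ V) : ∃ (φ : X → ℝ) (L : ℝ≥0), LipschitzWith L φ ∧ (∀ x, 0 ≤ φ x) ∧
      (∀ x, φ x ≤ 1) ∧ tsupport φ ∩ K ⊆ U ∧ tsupport (fun x => 1 - φ x) ∩ K ⊆ V := by
  have hA : IsCompact (K \ V) := hK.diff hV
  have hB : IsClosed (K \ U) := (hK.diff hU).isClosed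
  have hAB : Disjoint (K \ V) (K \ U) := by
    rw [Set.disjoint_left]
    rintro x ⟨hx, hxV⟩ ⟨-, hxU⟩
    rcases hKUV hx with h | h
    exacts [hxU h, hxV h]
  obtain ⟨δ, hδ, hdis⟩ := hAB.exists_cthickenings hA hB
  have hδ2 : 0 < δ / 2 := half_pos hδ
  let E := Metric.cthickening (δ / 2) (K \ V)
  refine ⟨fun x => (thickenedIndicator hδ2 E x : ℝ), (δ / 2).toNNReal⁻¹, ?_,
    fun x => NNReal.coe_nonneg _, fun x => by exact_mod_cast thickenedIndicator_le_one hδ2 E x, ?_, ?_⟩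
  · exact LipschitzWith.of_dist_le_mul fun x y =>
      (lipschitzWith_thickenedIndicator hδ2 E).dist_le_mul x y
  · rintro x ⟨hx, hxK⟩
    by_contra hxU
    have hsub : Function.support (fun x => (thickenedIndicator hδ2 E x : ℝ)) ⊆
        Metric.cthickening δ (K \ V) := by
      intro y hy
      by_contra hyn
      apply hy
      have : y ∉ Metric.thickening (δ / 2) E := by
        intro hmem
        apply hyn
        have h2 := Metric.thickening_cthickening_subset (δ / 2) hδ2.le (K \ V) hmem
        rw [add_halves] at h2
        exact Metric.thickening_subset_cthickening _ _ h2
      simp [thickenedIndicator_zero hδ2 E this]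
    have hx2 := closure_minimal hsub Metric.isClosed_cthickening hx
    exact Set.disjoint_left.1 hdis hx2 (Metric.self_subset_cthickening _ ⟨hxK, hxU⟩)
  · rintro x ⟨hx, hxK⟩
    by_contra hxV
    have hsub : Function.support (fun x => 1 - (thickenedIndicator hδ2 E x : ℝ)) ⊆
        (Metric.thickening (δ / 2) (K \ V))ᶜ := by
      intro y hy hmem
      apply hy
      simp [thickenedIndicator_one hδ2 E (Metric.thickening_subset_cthickening _ _ hmem)]
    have hx2 := closure_minimal hsub Metric.isOpen_thickening.isClosed_compl hx
    exact hx2 (Metric.self_subset_thickening hδ2 _ ⟨hxK, hxV⟩)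

theorem openMass_union_le (T : FormFunctional k X) {U V : Set X} (hU : IsOpen U) (hV : IsOpen V) :
    openMass T (U ∪ V) ≤ openMass T U + openMass T V := by
  refine openMass_le T fun n f g h => ?_
  have hK : IsCompact (⋃ s, tsupport (f s : X → ℝ)) := isCompact_iUnion fun s => (f s).2.2
  obtain ⟨φ, L, hL, h0, h1, hφU, hφV⟩ :=
    exists_lipschitz_cutoff hK hU hV (Set.iUnion_subset h.1)
  have hL' : LipschitzWith L (fun x => 1 - φ x) := LipschitzWith.of_dist_le_mul fun x y => by
    have := hL.dist_le_mul x y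
    rwa [Real.dist_eq, sub_sub_sub_cancel_left, ← Real.dist_eq, dist_comm]
  let a : Fin n → LipC X := fun s => ⟨_, mul_mem_LipC hL h0 h1 (f s)⟩
  let b : Fin n → LipC X := fun s => ⟨_, mul_mem_LipC hL' (fun x => by linarith [h1 x])
    (fun x => by linarith [h0 x]) (f s)⟩
  have hab : ∀ s, f s = a s + b s := fun s => Subtype.ext (funext fun x => by
    change (f s : X → ℝ) x = φ x * (f s : X → ℝ) x + (1 - φ x) * (f s : X → ℝ) x
    ring)
  have ha : IsUnitComassFamily U a g := by
    refine ⟨fun s => ?_, fun s i => (h.2.1 s i).mono (tsupport_mul_subset_right), fun x => ?_⟩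
    · exact fun x hx => hφU ⟨tsupport_mul_subset_left hx,
        Set.mem_iUnion.2 ⟨s, tsupport_mul_subset_right hx⟩⟩
    · refine (Finset.sum_le_sum fun s _ => ?_).trans (h.2.2 x)
      change |φ x * (f s : X → ℝ) x| ≤ _
      rw [abs_mul, abs_of_nonneg (h0 x)]
      exact mul_le_of_le_one_left (abs_nonneg _) (h1 x)
  have hb : IsUnitComassFamily V b g := by
    refine ⟨fun s => ?_, fun s i => (h.2.1 s i).mono (tsupport_mul_subset_right), fun x => ?_⟩
    · exact fun x hx => hφV ⟨tsupport_mul_subset_left hx,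
        Set.mem_iUnion.2 ⟨s, tsupport_mul_subset_right hx⟩⟩
    · refine (Finset.sum_le_sum fun s _ => ?_).trans (h.2.2 x)
      change |(1 - φ x) * (f s : X → ℝ) x| ≤ _
      rw [abs_mul, abs_of_nonneg (by linarith [h1 x])]
      exact mul_le_of_le_one_left (abs_nonneg _) (by linarith [h0 x])
  have hsum : ∑ s, T (f s) (g s) = ∑ s, T (a s) (g s) + ∑ s, T (b s) (g s) := by
    rw [← Finset.sum_add_distrib]
    refine Finset.sum_congr rfl fun s _ => ?_
    rw [hab s, map_add, add_apply]
  rw [hsum]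
  exact ENNReal.ofReal_add_le.trans (add_le_add (le_openMass T ha) (le_openMass T hb))

theorem openMass_biUnion_le (T : FormFunctional k X) (U : ℕ → Set X) (hU : ∀ i, IsOpen (U i))
    (I : Finset ℕ) : openMass T (⋃ i ∈ I, U i) ≤ ∑ i ∈ I, openMass T (U i) := by
  classical
  induction I using Finset.induction_on with
  | empty => simp [openMass_empty]
  | insert i I hi ih =>
    rw [Finset.sum_insert hi, Finset.set_biUnion_insert]
    exact (openMass_union_le T (hU i) (isOpen_biUnion fun j _ => hU j)).trans
      (add_le_add le_rfl ih)

theorem openMass_iUnion_le (T : FormFunctional k X) (U : ℕ → Set X) (hU : ∀ i, IsOpen (U i)) :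
    openMass T (⋃ i, U i) ≤ ∑' i, openMass T (U i) := by
  refine openMass_le T fun n f g h => ?_
  have hK : IsCompact (⋃ s, tsupport (f s : X → ℝ)) := isCompact_iUnion fun s => (f s).2.2
  obtain ⟨I, hI⟩ := hK.elim_finite_subcover U hU (Set.iUnion_subset h.1)
  have h' : IsUnitComassFamily (⋃ i ∈ I, U i) f g :=
    ⟨fun s => (Set.subset_iUnion _ s).trans hI, h.2⟩
  exact (le_openMass T h').trans ((openMass_biUnion_le T U hU I).trans (ENNReal.sum_le_tsum I))

end MassLemmas

/-- The mass `‖T‖` as an outer measure; see `massOuter_apply` for its values. -/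
noncomputable def massOuter {k : ℕ} {X : Type*} [MetricSpace X] (T : FormFunctional k X) :
    OuterMeasure X :=
  inducedOuterMeasure (fun U (_ : IsOpen U) => openMass T U) isOpen_empty (openMass_empty T)

/-- `‖T‖(A)` is the infimum of `‖T‖(U)` over the open sets `U` containing `A`. -/
theorem massOuter_apply {k : ℕ} {X : Type*} [MetricSpace X] (T : FormFunctional k X) (A : Set X) :
    massOuter T A = ⨅ (U : Set X) (_ : IsOpen U) (_ : A ⊆ U), openMass T U :=
  inducedOuterMeasure_eq_iInf (fun _ h => isOpen_iUnion h) (fun U hU => openMass_iUnion_le T U hU)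
    (fun _ _ _ _ h => openMass_mono T h) A

/-- On open sets `‖T‖` is given by the supremum over forms of comass at most `1`. -/
theorem massOuter_of_isOpen {k : ℕ} {X : Type*} [MetricSpace X] (T : FormFunctional k X)
    {U : Set X} (hU : IsOpen U) : massOuter T U = openMass T U :=
  inducedOuterMeasure_eq' (fun _ h => isOpen_iUnion h) (fun U hU => openMass_iUnion_le T U hU)
    (fun _ _ _ _ h => openMass_mono T h) hU

theorem massOuter_isMetric {k : ℕ} {X : Type*} [MetricSpace X] (T : FormFunctional k X) :
    (massOuter T).IsMetric := by
  intro s t hst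
  refine le_antisymm (measure_union_le s t) ?_
  obtain ⟨r, hr, hsep⟩ := hst
  have hr2 : 0 < r / 2 := ENNReal.half_pos hr
  rw [massOuter_apply T (s ∪ t)]
  refine le_iInf fun U => le_iInf fun hU => le_iInf fun hsub => ?_
  let N : Set X → Set X := fun A => ⋃ a ∈ A, Metric.eball a (r / 2)
  have hN : ∀ A, IsOpen (N A) := fun A => isOpen_biUnion fun a _ => Metric.isOpen_eball
  have hAN : ∀ A, A ⊆ N A := fun A a ha =>
    Set.mem_biUnion ha (Metric.mem_eball_self hr2)
  have hd : Disjoint (U ∩ N s) (U ∩ N t) := by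
    rw [Set.disjoint_left]
    rintro x ⟨-, hx⟩ ⟨-, hx'⟩
    obtain ⟨a, ha, hxa⟩ := Set.mem_iUnion₂.1 hx
    obtain ⟨b, hb, hxb⟩ := Set.mem_iUnion₂.1 hx'
    have h1 : edist a b < r := by
      calc edist a b ≤ edist a x + edist x b := edist_triangle _ _ _
        _ < r / 2 + r / 2 := by
            refine ENNReal.add_lt_add ?_ hxb
            rw [edist_comm]; exact hxa
        _ = r := ENNReal.add_halves r
    exact absurd (hsep a ha b hb) (not_le.2 h1)
  calc massOuter T s + massOuter T t
      ≤ massOuter T (U ∩ N s) + massOuter T (U ∩ N t) :=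
        add_le_add
          (measure_mono fun x hx => ⟨hsub (Or.inl hx), hAN s hx⟩)
          (measure_mono fun x hx => ⟨hsub (Or.inr hx), hAN t hx⟩)
    _ = openMass T (U ∩ N s) + openMass T (U ∩ N t) := by
        rw [massOuter_of_isOpen T (hU.inter (hN s)), massOuter_of_isOpen T (hU.inter (hN t))]
    _ ≤ openMass T U := openMass_add_le T Set.inter_subset_left Set.inter_subset_left hd

/-- The mass `‖T‖` as a Borel measure. -/
noncomputable def massMeasure {k : ℕ} {X : Type*} [MetricSpace X] [MeasurableSpace X]
    [BorelSpace X] (T : FormFunctional k X) : Measure X :=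
  (massOuter T).toMeasure (by
    rw [BorelSpace.measurable_eq (α := X)]
    exact (massOuter_isMetric T).borel_le_caratheodory)

/-- `T` has locally finite mass. -/
def MetricCurrent.HasLocallyFiniteMass {k : ℕ} {X : Type*} [MetricSpace X]
    (T : MetricCurrent k X) : Prop :=
  ∀ A : Set X, IsCompact (closure A) → massOuter T.toFun A < ⊤

/-- `T` is concentrated on `A`: the mass of `T` vanishes outside `A`. -/
def MetricCurrent.IsConcentratedOn {k : ℕ} {X : Type*} [MetricSpace X]
    (T : MetricCurrent k X) (A : Set X) : Prop :=
  massOuter T.toFun Aᶜ = 0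

/-! ## Extension of currents to bounded Borel coefficients -/

/-- `β` is a bounded Borel function with compact support. -/
def IsBoundedBorelC {X : Type*} [MetricSpace X] [MeasurableSpace X] (β : X → ℝ) : Prop :=
  Measurable β ∧ (∃ C : ℝ, ∀ x, |β x| ≤ C) ∧ HasCompactSupport β

/-- The functions `f n`, all supported in one compact set, converge to `β` in `L¹(X, ‖T‖)`. -/
def MetricCurrent.ApproxInL1 {k : ℕ} {X : Type*} [MetricSpace X] [MeasurableSpace X]
    [BorelSpace X] (T : MetricCurrent k X) (f : ℕ → LipC X) (β : X → ℝ) : Prop :=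
  (∃ K : Set X, IsCompact K ∧ ∀ n, tsupport (f n : X → ℝ) ⊆ K) ∧
  Tendsto (fun n => ∫⁻ x, ENNReal.ofReal |(f n : X → ℝ) x - β x| ∂(massMeasure T.toFun))
    atTop (𝓝 0)

/-- The canonical extension of `T` to forms with coefficients in the bounded Borel functions of
compact support takes the value `t` at `β dg¹ ∧ … ∧ dgᵏ`: there are functions in `Lip_c(X)`
approximating `β` in `L¹(X, ‖T‖)`, and `T(f_n dg¹ ∧ … ∧ dgᵏ) → t` for every such approximation.
(So `t` is unique.) -/
def MetricCurrent.HasValue {k : ℕ} {X : Type*} [MetricSpace X] [MeasurableSpace X]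
    [BorelSpace X] (T : MetricCurrent k X) (β : X → ℝ) (g : Fin k → LipLoc X) (t : ℝ) : Prop :=
  (∃ f : ℕ → LipC X, T.ApproxInL1 f β) ∧
  ∀ f : ℕ → LipC X, T.ApproxInL1 f β → Tendsto (fun n => T.toFun (f n) g) atTop (𝓝 t)

/-! ## Strong measured differentiable structures -/

section Differentials

variable {X : Type*} [MetricSpace X] {E : Type*} [NormedAddCommGroup E] [InnerProductSpace ℝ E]

/-- `D ∈ E*` is a differential of `f` at `y ∈ Y` with respect to `π : Y → E`:
`f(x) = f(y) + ⟨D, π(x) - π(y)⟩ + o(dist(x, y))` as `x → y` in `Y`. -/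
def IsDifferentialAt {Y : Set X} (π : Y → E) (f : X → ℝ) (y : Y) (D : StrongDual ℝ E) : Prop :=
  (fun x : Y => f x - f y - D (π x - π y)) =o[𝓝 y] (fun x : Y => dist x y)

/-- `f` is differentiable at `y`: it has a unique differential there. -/
def IsDifferentiableAt {Y : Set X} (π : Y → E) (f : X → ℝ) (y : Y) : Prop :=
  ∃! D : StrongDual ℝ E, IsDifferentialAt π f y D

open Classical in
/-- The differential of `f` at `y` with respect to `π` (`0` if `f` is not differentiable). -/
noncomputable def cheegerDiff {Y : Set X} (π : Y → E) (f : X → ℝ) (y : Y) : StrongDual ℝ E :=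
  if h : IsDifferentiableAt π f y then h.choose else 0

/-- `(Y, π)` is a coordinate patch (chart): `π : Y → E` is Lipschitz, and for each Lipschitz
function `f` on `X` there are a subset `Y_f` of full measure in `Y` and a unique measurable
`D : Y_f → E*` such that `D y` is a differential of `f` at `y` for all `y ∈ Y_f`. -/
def IsCoordinatePatch [MeasurableSpace X] (μ : Measure X) (Y : Set X) (π : Y → E) : Prop :=
  (∃ L : ℝ≥0, LipschitzWith L π) ∧
  ∀ f : X → ℝ, (∃ L : ℝ≥0, LipschitzWith L f) →
    ∃ Yf : Set Y, μ (Subtype.val '' Yfᶜ) = 0 ∧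
      ∃! D : Yf → StrongDual ℝ E, Measurable D ∧ ∀ y : Yf, IsDifferentialAt π f y (D y)

/-- The metric measure space `(X, μ)` admits a strong measured differentiable structure: it is a
countable union of coordinate patches. -/
def AdmitsStrongMeasuredDifferentiableStructure [MeasurableSpace X] (μ : Measure X) : Prop :=
  ∃ (Y : ℕ → Set X) (n : ℕ → ℕ) (π : ∀ j, Y j → EuclideanSpace ℝ (Fin (n j))),
    (∀ j, IsCoordinatePatch μ (Y j) (π j)) ∧ ⋃ j, Y j = Set.univ

/-- The set `Y_ω` of the points `y ∈ Y` at which all `g_sⁱ` are differentiable and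
`∑ β_s(y) dg_s¹ ∧ … ∧ dg_sᵏ = 0` in the exterior power `⋀ᵏ E*`, the differentials being taken with
respect to the chart. -/
def cheegerVanishingSet {Y : Set X} (π : Y → E) {k : ℕ} {S : Type*} [Fintype S]
    (β : S → X → ℝ) (g : S → Fin k → LipLoc X) : Set X :=
  Subtype.val '' {y : Y | (∀ s i, IsDifferentiableAt π (g s i : X → ℝ) y) ∧
    ∑ s, β s y • exteriorPower.ιMulti ℝ k (fun i => cheegerDiff π (g s i : X → ℝ) y) = 0}

end Differentials

/-! On a small enough set the functions $g_s^i$ look like linear functions of the chart, and on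
linear functions of the chart $T$ sees only the covector $\sum_s\beta_s D_s^1\wedge\dots\wedge
D_s^k$. Given $\varepsilon$, countably many Borel pieces $P$ cover $Y_\omega$. Each comes with fixed
$D_s^i\in\mathbb E^*$ such that $g_s^i-D_s^i\circ\pi$ is $\varepsilon$-Lipschitz on $P$ and this
covector has coordinates at most $\varepsilon$ on $P$.

For Borel $B\subseteq P$, replacing $g_s^i$ by $D_s^i\circ\pi$ in $T(1_B\omega)$ costs
$O(\varepsilon)\|T\|(B\cap K)$, and the new value is again $O(\varepsilon)\|T\|(B\cap K)$, where $K$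
carries the $\beta_s$ and the constants do not depend on $\varepsilon$, $P$ or $D$
(`MetricCurrent.exists_abs_sum_restrict_le`). As $T$ is concentrated on $Y_\omega$, these bounds add
up over the pieces (`abs_le_mul_measureReal_of_cover`) to $|T(\omega)|\le C\varepsilon\|T\|(K)$, and
$\varepsilon\to0$.

The replacement rests on $|T(\beta\,dg)|\le\prod_i\mathrm{Lip}(g^i|_B)\int|\beta|\,d\|T\|$ for any
set $B$ off which $\beta$ vanishes (`MetricCurrent.abs_borelExtension_le`). For Lipschitz
coefficients this is a layer-cake argument from the definition of the mass
(`MetricCurrent.abs_posPart_le`); density carries it to Borel ones. Only the values of $g^i$ where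
$\beta\ne0$ matter (`MetricCurrent.borelExtension_congr`), so $g^i$ may be replaced by a Lipschitz
extension of its restriction to $B$.

The second bound needs $T$ to be alternating, which is not an axiom
(`MetricCurrent.borelExtension_eq_zero_of_eq`). Two equal entries $h,h$ are perturbed to
$h\pm\mathrm{dist}(h,a^{-1}\mathbb Z)$; on each piece of a countable partition one of these is
constant, so locality kills the value, and $a\to\infty$. Hence $T$ on linear functions of the chart
factors through $\bigwedge^k\mathbb E^*$ (`MetricCurrent.chartCovector`). -/

/-! ### Lipschitz function spaces. -/

section LipschitzSpaces

variable {X : Type*} [MetricSpace X]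

theorem LipC.continuous (f : LipC X) : Continuous (f : X → ℝ) := by
  obtain ⟨⟨L, hL⟩, -⟩ := f.2
  exact hL.continuous

theorem LipLoc.exists_lipschitzOnWith (g : LipLoc X) {K : Set X} (hK : IsCompact K) :
    ∃ L : ℝ≥0, LipschitzOnWith L (g : X → ℝ) K :=
  (LocallyLipschitz.locallyLipschitzOn g.2).exists_lipschitzOnWith_of_compact hK

theorem LipLoc.continuous (g : LipLoc X) : Continuous (g : X → ℝ) :=
  LocallyLipschitz.continuous g.2

theorem comp_mem_LipC {φ : ℝ → ℝ} {L : ℝ≥0} (hφ : LipschitzWith L φ) (h0 : φ 0 = 0) (f : LipC X) :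
    (fun x => φ ((f : X → ℝ) x)) ∈ LipC X := by
  obtain ⟨⟨M, hM⟩, hf⟩ := f.2
  exact ⟨⟨_, hφ.comp hM⟩, hf.comp_left h0⟩

theorem comp_mem_LipLoc {φ : ℝ → ℝ} {L : ℝ≥0} (hφ : LipschitzWith L φ) (g : LipLoc X) :
    (fun x => φ ((g : X → ℝ) x)) ∈ LipLoc X :=
  LocallyLipschitz.comp hφ.locallyLipschitz g.2

/-- A locally Lipschitz function times a compactly supported Lipschitz function. -/
theorem locallyLipschitz_mul_mem_LipC {u : X → ℝ} (hu : LocallyLipschitz u) (f : LipC X) :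
    (fun x => u x * (f : X → ℝ) x) ∈ LipC X := by
  obtain ⟨f, ⟨M, hM⟩, hf⟩ := f
  refine ⟨?_, hf.mul_left⟩
  obtain ⟨L, hL⟩ := LipLoc.exists_lipschitzOnWith ⟨u, hu⟩ hf
  obtain ⟨C, hC⟩ := hf.exists_bound_of_continuousOn hu.continuous.continuousOn
  obtain ⟨A, hA⟩ := hM.continuous.bounded_above_of_compact_support hf
  have hA0 : ∀ x, |f x| ≤ A.toNNReal := fun x => (hA x).trans (Real.le_coe_toNNReal A)
  have hC0 : ∀ x ∈ tsupport f, |u x| ≤ C.toNNReal :=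
    fun x hx => (hC x hx).trans (Real.le_coe_toNNReal C)
  have e1 : ∀ x y, |f x - f y| ≤ M * dist x y := fun x y => by
    simpa [Real.dist_eq] using hM.dist_le_mul x y
  refine ⟨C.toNNReal * M + L * A.toNNReal, LipschitzWith.of_dist_le_mul fun x y => ?_⟩
  push_cast
  change |u x * f x - u y * f y| ≤ _
  have hd := dist_nonneg (x := x) (y := y)
  -- The bounds on `u` hold only on the support of `f`, so points outside it are treated separately.
  by_cases hx : x ∈ tsupport f
  · have e5 : u x * f x - u y * f y = u x * (f x - f y) + (u x - u y) * f y := by ring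
    rw [e5]
    refine (abs_add_le _ _).trans ?_
    rw [abs_mul, abs_mul]
    have i1 : |u x| * |f x - f y| ≤ C.toNNReal * (M * dist x y) :=
      mul_le_mul (hC0 x hx) (e1 x y) (abs_nonneg _) (NNReal.coe_nonneg _)
    have i2 : |u x - u y| * |f y| ≤ (L * dist x y) * A.toNNReal := by
      by_cases hy : y ∈ tsupport f
      · refine mul_le_mul ?_ (hA0 y) (abs_nonneg _) (by positivity)
        simpa [Real.dist_eq] using hL.dist_le_mul x hx y hy
      · rw [image_eq_zero_of_notMem_tsupport hy, abs_zero, mul_zero]; positivity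
    linarith
  · have hfx : f x = 0 := image_eq_zero_of_notMem_tsupport hx
    rw [hfx, mul_zero, zero_sub, abs_neg, abs_mul]
    by_cases hy : y ∈ tsupport f
    · have i1 : |u y| * |f y| ≤ C.toNNReal * (M * dist x y) := by
        refine mul_le_mul (hC0 y hy) ?_ (abs_nonneg _) (NNReal.coe_nonneg _)
        simpa [hfx] using e1 x y
      have : (0:ℝ) ≤ L * A.toNNReal * dist x y := by positivity
      linarith
    · rw [image_eq_zero_of_notMem_tsupport hy, abs_zero, mul_zero]; positivity

end LipschitzSpaces

/-! ### The mass bound for Lipschitz coefficients. -/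

section Mass

variable {X : Type*} [MetricSpace X] [MeasurableSpace X] [BorelSpace X] {k : ℕ}

theorem massMeasure_of_isOpen (T : FormFunctional k X) {U : Set X} (hU : IsOpen U) :
    massMeasure T U = openMass T U := by
  rw [massMeasure, toMeasure_apply _ _ hU.measurableSet, massOuter_of_isOpen T hU]

/-- Both sides agree on open sets and the right side is an infimum over them. It is needed for sets
not known to be Borel, such as the complement of $Y_\omega$. -/
theorem massMeasure_le_massOuter (T : FormFunctional k X) (A : Set X) :
    massMeasure T A ≤ massOuter T A := by
  rw [massOuter_apply]
  exact le_iInf fun U => le_iInf fun hU => le_iInf fun hA =>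
    (measure_mono hA).trans (massMeasure_of_isOpen T hU).le

theorem MetricCurrent.HasLocallyFiniteMass.isFiniteMeasureOnCompacts {T : MetricCurrent k X}
    (hT : T.HasLocallyFiniteMass) : IsFiniteMeasureOnCompacts (massMeasure T.toFun) :=
  ⟨fun K hK => (massMeasure_le_massOuter _ K).trans_lt (hT K (hK.isClosed.closure_eq.symm ▸ hK))⟩

/-- One-element families in the supremum defining the mass, applied to `f` and to `-f`. -/
theorem abs_le_massMeasure (T : FormFunctional k X) {U : Set X} (hU : IsOpen U)
    (hfin : massMeasure T U ≠ ⊤) {f : LipC X} {g : Fin k → LipLoc X}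
    (hfU : tsupport (f : X → ℝ) ⊆ U) (hf : ∀ x, |(f : X → ℝ) x| ≤ 1)
    (hg : ∀ i, LipschitzOnWith 1 (g i : X → ℝ) (tsupport (f : X → ℝ))) :
    |T f g| ≤ (massMeasure T).real U := by
  have key : ∀ f' : LipC X, tsupport (f' : X → ℝ) = tsupport (f : X → ℝ) →
      (∀ x, |(f' : X → ℝ) x| ≤ 1) → T f' g ≤ (massMeasure T).real U := by
    intro f' hs h1
    have := le_openMass T (U := U) (n := 1) (f := fun _ => f') (g := fun _ => g)
      ⟨fun _ => hs ▸ hfU, fun _ i => hs ▸ hg i, fun x => by simpa using h1 x⟩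
    rw [← massMeasure_of_isOpen T hU] at this
    rw [Measure.real]
    simpa using (ENNReal.ofReal_le_iff_le_toReal hfin).1 this
  refine abs_le'.2 ⟨key f rfl hf, ?_⟩
  have hs : tsupport ((-f : LipC X) : X → ℝ) = tsupport (f : X → ℝ) := by
    simp only [tsupport, Submodule.coe_neg, Function.support_neg]
  have := key (-f) hs (fun x => by simpa using hf x)
  simpa using this

/-- The part of `t` lying between the levels `j ε` and `(j + 1) ε`. -/
def slice (ε : ℝ) (j : ℕ) (t : ℝ) : ℝ := min (max (t - j * ε) 0) ε

theorem lipschitzWith_slice (ε : ℝ) (j : ℕ) : LipschitzWith 1 (slice ε j) := by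
  have : LipschitzWith 1 fun t : ℝ => t - j * ε :=
    LipschitzWith.of_dist_le_mul fun x y => by simp
  exact (this.max_const 0).min_const ε

theorem sum_slice {ε : ℝ} (hε : 0 < ε) (N : ℕ) (t : ℝ) :
    ∑ j ∈ Finset.range N, slice ε j t = min (max t 0) (N * ε) := by
  induction N with
  | zero => simp
  | succ N ih =>
    rw [Finset.sum_range_succ, ih, slice]
    have : 0 ≤ (N : ℝ) * ε := by positivity
    push_cast
    grind

/-- If level `N` still counts, then `(N - 1) ε < t`, so all `N + 1` terms together are at most `(N +
1) ε < t + 2 ε`. -/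
theorem sum_indicator_level_le {ε : ℝ} (hε : 0 < ε) (N : ℕ) (t : ℝ) :
    ∑ j ∈ Finset.range N, (if ((j : ℝ) - 1) * ε < t then ε else 0) ≤ max t 0 + 2 * ε := by
  induction N with
  | zero => simp; positivity
  | succ N ih =>
    rw [Finset.sum_range_succ]
    split_ifs with h
    · have : ∑ j ∈ Finset.range N, (if ((j : ℝ) - 1) * ε < t then ε else 0) ≤ N * ε := by
        refine (Finset.sum_le_card_nsmul _ _ ε fun j _ => ?_).trans (by simp)
        split_ifs <;> linarith
      have h2 := le_max_left t 0
      linarith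
    · simpa using ih

variable [LocallyCompactSpace X]

/-- The mass bound on the positive part of the coefficient. -/
theorem MetricCurrent.abs_posPart_le {T : MetricCurrent k X} (hT : T.HasLocallyFiniteMass)
    {f p : LipC X} (hp : ∀ x, (p : X → ℝ) x = max ((f : X → ℝ) x) 0) {g : Fin k → LipLoc X}
    (hg : ∀ i, LipschitzOnWith 1 (g i : X → ℝ) (tsupport (f : X → ℝ))) :
    |T.toFun p g| ≤ ∫ x, max ((f : X → ℝ) x) 0 ∂massMeasure T.toFun := by
  set M := massMeasure T.toFun
  have := hT.isFiniteMeasureOnCompacts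
  obtain ⟨V, hV, hfV, hVc⟩ := exists_isOpen_superset_and_isCompact_closure f.2.2
  have hVfin : M V < ⊤ := (measure_mono subset_closure).trans_lt hVc.measure_lt_top
  have hpint : Integrable (fun x => max ((f : X → ℝ) x) 0) M := by
    have : (fun x => max ((f : X → ℝ) x) 0) = (p : X → ℝ) := funext fun x => (hp x).symm
    rw [this]
    exact (LipC.continuous p).integrable_of_hasCompactSupport p.2.2
  obtain ⟨A, hA⟩ := (LipC.continuous f).bounded_above_of_compact_support f.2.2
  have hfle : ∀ x, (f : X → ℝ) x ≤ A := fun x => (le_abs_self _).trans (hA x)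
  have main : ∀ ε : ℝ, 0 < ε → |T.toFun p g| ≤
      (∫ x, max ((f : X → ℝ) x) 0 ∂M) + 2 * ε * M.real V := by
    intro ε hε
    obtain ⟨N, hN⟩ : ∃ N : ℕ, A ≤ N * ε := by
      obtain ⟨N, hN⟩ := exists_nat_ge (A / ε)
      exact ⟨N, (div_le_iff₀ hε).1 hN⟩
    have h00 : ∀ j, slice ε j 0 = 0 := fun j => by
      have : 0 ≤ (j : ℝ) * ε := by positivity
      simp [slice, this, hε.le]
    -- The `j`-th layer of `f` has its closed support in `{j ε ≤ f}`; one level is given away to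
    -- have an open set around it. Intersecting with `V` keeps the mass finite, since `U 0` would
    -- otherwise contain the zero set of `f`.
    let U : ℕ → Set X := fun j => V ∩ {x | ((j : ℝ) - 1) * ε < (f : X → ℝ) x}
    have hU : ∀ j, IsOpen (U j) := fun j =>
      hV.inter (isOpen_lt continuous_const (LipC.continuous f))
    have hUfin : ∀ j, M (U j) < ⊤ := fun j => (measure_mono Set.inter_subset_left).trans_lt hVfin
    let c : ℕ → LipC X := fun j => ⟨_, comp_mem_LipC (lipschitzWith_slice ε j) (h00 j) f⟩
    have hsup : ∀ j, tsupport (c j : X → ℝ) ⊆ tsupport (f : X → ℝ) := fun j =>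
      tsupport_comp_subset (h00 j) _
    -- As `f ≤ A ≤ N ε`, the `N` layers exhaust the positive part.
    have hpc : p = ∑ j ∈ Finset.range N, c j := by
      apply Subtype.ext
      funext x
      rw [Submodule.coe_sum, Finset.sum_apply, hp]
      change _ = ∑ j ∈ Finset.range N, slice ε j ((f : X → ℝ) x)
      rw [sum_slice hε, min_eq_left]
      have : 0 ≤ (N : ℝ) * ε := by positivity
      exact max_le ((hfle x).trans hN) this
    have hc : ∀ j, |T.toFun (c j) g| ≤ ε * M.real (U j) := by
      intro j
      have hss : tsupport ((ε⁻¹ • c j : LipC X) : X → ℝ) ⊆ tsupport (c j : X → ℝ) :=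
        closure_mono (Function.support_const_smul_subset _ _)
      have := abs_le_massMeasure T.toFun (hU j) (hUfin j).ne (f := ε⁻¹ • c j) (g := g)
        (hss.trans (Set.subset_inter ((hsup j).trans hfV) ?_)) ?_
        (fun i => (hg i).mono (hss.trans (hsup j)))
      · rw [map_smul, smul_apply, smul_eq_mul, abs_mul, abs_of_pos (inv_pos.2 hε)] at this
        rwa [inv_mul_le_iff₀ hε] at this
      · have : tsupport (c j : X → ℝ) ⊆ {x | (j : ℝ) * ε ≤ (f : X → ℝ) x} := by
          refine closure_minimal (fun x hx => ?_)
            (isClosed_le continuous_const (LipC.continuous f))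
          by_contra hlt
          simp only [Set.mem_ofPred_eq, not_le] at hlt
          apply hx
          change slice ε j ((f : X → ℝ) x) = 0
          simp [slice, hlt.le, hε.le]
        intro x hx
        have hx := this hx
        simp only [Set.mem_ofPred_eq] at hx ⊢
        linarith
      · intro x
        change |ε⁻¹ * slice ε j ((f : X → ℝ) x)| ≤ 1
        have h1 : 0 ≤ slice ε j ((f : X → ℝ) x) := le_min (le_max_right _ _) hε.le
        have h2 : slice ε j ((f : X → ℝ) x) ≤ ε := min_le_right _ _
        rw [abs_of_nonneg (by positivity), inv_mul_le_iff₀ hε]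
        linarith
    have hmeas : ∀ j, MeasurableSet (U j) := fun j => (hU j).measurableSet
    have hint : ∀ j ∈ Finset.range N, Integrable ((U j).indicator fun _ => ε) M := fun j _ =>
      (integrable_indicator_iff (hmeas j)).2 (integrableOn_const (hUfin j).ne)
    calc |T.toFun p g| = |∑ j ∈ Finset.range N, T.toFun (c j) g| := by
          rw [hpc, map_sum, sum_apply]
      _ ≤ ∑ j ∈ Finset.range N, ε * M.real (U j) :=
          (Finset.abs_sum_le_sum_abs _ _).trans (Finset.sum_le_sum fun j _ => hc j)
      _ = ∫ x, ∑ j ∈ Finset.range N, (U j).indicator (fun _ => ε) x ∂M := by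
          rw [integral_finsetSum _ hint]
          refine Finset.sum_congr rfl fun j _ => ?_
          rw [integral_indicator_const _ (hmeas j), smul_eq_mul, mul_comm]
      _ ≤ ∫ x, (max ((f : X → ℝ) x) 0 + V.indicator (fun _ => 2 * ε) x) ∂M := by
          refine integral_mono (integrable_finsetSum _ hint) (hpint.add
            ((integrable_indicator_iff hV.measurableSet).2 (integrableOn_const hVfin.ne)))
            fun x => ?_
          by_cases hx : x ∈ V
          · refine le_trans (le_of_eq ?_) ((sum_indicator_level_le hε N ((f : X → ℝ) x)).trans ?_)
            · refine Finset.sum_congr rfl fun j _ => ?_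
              simp [Set.indicator, U, hx]
            · simp [hx]
          · have : ∀ j, x ∉ U j := fun j h => hx h.1
            simp [this, hx]
      _ = (∫ x, max ((f : X → ℝ) x) 0 ∂M) + 2 * ε * M.real V := by
          rw [integral_add hpint
            ((integrable_indicator_iff hV.measurableSet).2 (integrableOn_const hVfin.ne)),
            integral_indicator_const _ hV.measurableSet, smul_eq_mul, mul_comm (M.real V)]
  refine le_of_forall_pos_le_add fun δ hδ => ?_
  have hM0 : 0 ≤ M.real V := measureReal_nonneg
  -- This choice makes the error `2 ε M(V)` at most `δ`; the `+ 1` avoids dividing by zero.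
  refine (main (δ / (2 * (M.real V + 1))) (by positivity)).trans ?_
  gcongr
  have : 2 * (δ / (2 * (M.real V + 1))) * M.real V = δ * (M.real V / (M.real V + 1)) := by
    field_simp
  rw [this]
  exact mul_le_of_le_one_right hδ.le ((div_le_one (by positivity)).2 (by linarith))

theorem MetricCurrent.abs_le_integral_of_lipschitzOnWith_one {T : MetricCurrent k X}
    (hT : T.HasLocallyFiniteMass) {f : LipC X} {g : Fin k → LipLoc X}
    (hg : ∀ i, LipschitzOnWith 1 (g i : X → ℝ) (tsupport (f : X → ℝ))) :
    |T.toFun f g| ≤ ∫ x, |(f : X → ℝ) x| ∂massMeasure T.toFun := by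
  have := hT.isFiniteMeasureOnCompacts
  have hL : LipschitzWith 1 fun t : ℝ => max t 0 := LipschitzWith.id.max_const 0
  let P : LipC X → LipC X := fun f => ⟨_, comp_mem_LipC hL (by simp) f⟩
  have hint : ∀ f : LipC X, Integrable (f : X → ℝ) (massMeasure T.toFun) := fun f =>
    (LipC.continuous f).integrable_of_hasCompactSupport f.2.2
  have hs : tsupport ((-f : LipC X) : X → ℝ) = tsupport (f : X → ℝ) := by
    simp only [tsupport, Submodule.coe_neg, Function.support_neg]
  have h1 := T.abs_posPart_le hT (f := f) (p := P f) (fun _ => rfl) hg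
  have h2 := T.abs_posPart_le hT (f := -f) (p := P (-f)) (fun _ => rfl) (fun i => hs ▸ hg i)
  have hsub : f = P f - P (-f) := by
    apply Subtype.ext
    funext x
    change (f : X → ℝ) x = max ((f : X → ℝ) x) 0 - max (-(f : X → ℝ) x) 0
    grind
  have habs : ∀ x, |(f : X → ℝ) x| = (P f : X → ℝ) x + (P (-f) : X → ℝ) x := fun x => by
    change _ = max ((f : X → ℝ) x) 0 + max (-(f : X → ℝ) x) 0
    grind
  calc |T.toFun f g| = |T.toFun (P f) g - T.toFun (P (-f)) g| := by
        conv_lhs => rw [hsub]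
        rw [map_sub, sub_apply]
    _ ≤ |T.toFun (P f) g| + |T.toFun (P (-f)) g| := abs_sub _ _
    _ ≤ _ := add_le_add h1 h2
    _ = _ := by
        simp_rw [habs]
        exact (integral_add (hint (P f)) (hint (P (-f)))).symm

/-- The mass bound: `|T(f dg¹ ∧ … ∧ dgᵏ)| ≤ ∏ Lip(gⁱ) ∫ |f| d‖T‖`. -/
theorem MetricCurrent.abs_le_prod_mul_integral {T : MetricCurrent k X}
    (hT : T.HasLocallyFiniteMass) {f : LipC X} {g : Fin k → LipLoc X} {L : Fin k → ℝ≥0}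
    (hg : ∀ i, LipschitzOnWith (L i) (g i : X → ℝ) (tsupport (f : X → ℝ))) :
    |T.toFun f g| ≤ (∏ i, (L i : ℝ)) * ∫ x, |(f : X → ℝ) x| ∂massMeasure T.toFun := by
  -- A zero Lipschitz constant makes `g i` constant on the support, so locality applies; otherwise
  -- each `g i` is normalised by `L i`.
  by_cases h0 : ∃ i, L i = 0
  · obtain ⟨i, hi⟩ := h0
    have : T.toFun f g = 0 := by
      rcases (tsupport (f : X → ℝ)).eq_empty_or_nonempty with he | ⟨y, hy⟩
      · have : f = 0 := Subtype.ext (tsupport_eq_empty_iff.1 he)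
        simp [this]
      · refine T.locality f g i ((g i : X → ℝ) y) fun x hx => ?_
        have := (hg i).dist_le_mul x hx y hy
        rw [hi] at this
        simpa using this
    rw [this, abs_zero]
    exact mul_nonneg (Finset.prod_nonneg fun i _ => (L i).coe_nonneg)
      (integral_nonneg fun _ => abs_nonneg _)
  · push Not at h0
    let g' : Fin k → LipLoc X := fun i => ((L i : ℝ)⁻¹) • g i
    have hgg : g = fun i => (L i : ℝ) • g' i := by
      funext i
      have : (L i : ℝ) ≠ 0 := by exact_mod_cast h0 i
      simp only [g', smul_smul, mul_inv_cancel₀ this, one_smul]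
    have h1 : ∀ i, LipschitzOnWith 1 (g' i : X → ℝ) (tsupport (f : X → ℝ)) := by
      intro i
      refine LipschitzOnWith.of_dist_le_mul fun x hx y hy => ?_
      have hpos : (0 : ℝ) < L i := by exact_mod_cast pos_iff_ne_zero.2 (h0 i)
      have := (hg i).dist_le_mul x hx y hy
      change dist ((L i : ℝ)⁻¹ * (g i : X → ℝ) x) ((L i : ℝ)⁻¹ * (g i : X → ℝ) y) ≤ _
      rw [Real.dist_eq, ← mul_sub, abs_mul, abs_of_pos (inv_pos.2 hpos), inv_mul_le_iff₀ hpos,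
        ← Real.dist_eq]
      simpa using this
    rw [hgg, MultilinearMap.map_smul_univ, smul_eq_mul, abs_mul,
      abs_of_nonneg (Finset.prod_nonneg fun i _ => (L i).coe_nonneg)]
    exact mul_le_mul_of_nonneg_left (T.abs_le_integral_of_lipschitzOnWith_one hT h1)
      (Finset.prod_nonneg fun i _ => (L i).coe_nonneg)

end Mass

/-! ### Density of compactly supported Lipschitz functions in $L^1$. -/

section Density

variable {X : Type*} [MetricSpace X] [LocallyCompactSpace X]

theorem exists_LipC_cutoff {C U : Set X} (hC : IsCompact C) (hU : IsOpen U) (hCU : C ⊆ U) :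
    ∃ φ : LipC X, (∀ x, 0 ≤ (φ : X → ℝ) x) ∧ (∀ x, (φ : X → ℝ) x ≤ 1) ∧
      (∀ x ∈ C, (φ : X → ℝ) x = 1) ∧ tsupport (φ : X → ℝ) ⊆ U := by
  obtain ⟨δ₁, hδ₁, h1⟩ := hC.exists_isCompact_cthickening
  obtain ⟨δ₂, hδ₂, h2⟩ := hC.exists_cthickening_subset_open hU hCU
  have hδ : 0 < min δ₁ δ₂ := lt_min hδ₁ hδ₂
  have hsub : tsupport (fun x => (thickenedIndicator hδ C x : ℝ)) ⊆
      Metric.cthickening (min δ₁ δ₂) C := by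
    refine closure_minimal (fun x hx => ?_) Metric.isClosed_cthickening
    by_contra h
    apply hx
    have : x ∉ Metric.thickening (min δ₁ δ₂) C := fun h' =>
      h (Metric.thickening_subset_cthickening _ _ h')
    simp [thickenedIndicator_zero hδ C this]
  refine ⟨⟨fun x => (thickenedIndicator hδ C x : ℝ), ⟨_, LipschitzWith.of_dist_le_mul fun x y =>
      (lipschitzWith_thickenedIndicator hδ C).dist_le_mul x y⟩, ?_⟩,
    fun x => NNReal.coe_nonneg _, fun x => by exact_mod_cast thickenedIndicator_le_one hδ C x,
    fun x hx => by simp [thickenedIndicator_one hδ C hx],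
    hsub.trans ((Metric.cthickening_mono (min_le_right _ _) _).trans h2)⟩
  exact h1.of_isClosed_subset (isClosed_tsupport _)
    (hsub.trans (Metric.cthickening_mono (min_le_left _ _) _))

variable [MeasurableSpace X] [BorelSpace X]

/-- It suffices to treat indicators of sets `s` of finite measure. Regularity gives a compact `C ⊆
s` and an open `U ⊇ C` with `s \ C` and `U \ C` small; a cutoff between `C` and `U` differs from the
indicator only on those two sets. `U` need not contain `s`. -/
theorem exists_LipC_eLpNorm_sub_le {M : Measure X} [M.Regular] {β : X → ℝ} (hβ : MemLp β 1 M)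
    {ε : ℝ≥0∞} (hε : ε ≠ 0) : ∃ f : LipC X, eLpNorm (β - (f : X → ℝ)) 1 M ≤ ε := by
  suffices h : ∃ g : X → ℝ, eLpNorm (β - g) 1 M ≤ ε ∧ ∃ f : LipC X, g = (f : X → ℝ) by
    obtain ⟨_, hg, f, rfl⟩ := h
    exact ⟨f, hg⟩
  refine MemLp.induction_dense ENNReal.one_ne_top
    (fun g => ∃ f : LipC X, g = (f : X → ℝ)) ?_ ?_ ?_ hβ hε
  · intro c s hs hsfin ε hε
    obtain ⟨η, hη, h⟩ := exists_eLpNorm_indicator_le (μ := M) (p := 1) ENNReal.one_ne_top c hε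
    have hη2 : ((η / 2 : ℝ≥0) : ℝ≥0∞) ≠ 0 := by
      simpa using (half_pos hη).ne'
    obtain ⟨C, hCs, hC, hsC⟩ := hs.exists_isCompact_sdiff_lt hsfin.ne hη2
    obtain ⟨U, hCU, hU, hUlt⟩ := C.exists_isOpen_lt_add (μ := M) hC.measure_lt_top.ne hη2
    have hUC : M (U \ C) < (η / 2 : ℝ≥0) :=
      measure_sdiff_lt_of_lt_add hC.measurableSet.nullMeasurableSet hCU hC.measure_lt_top.ne hUlt
    obtain ⟨φ, h0, h1, hφ1, hφU⟩ := exists_LipC_cutoff hC hU hCU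
    refine ⟨_, ?_, c • φ, rfl⟩
    have hle : M (U \ C ∪ s \ C) ≤ η := by
      refine (measure_union_le _ _).trans ((add_le_add hUC.le hsC.le).trans ?_)
      rw [← ENNReal.coe_add, add_halves]
    refine le_trans (eLpNorm_mono fun x => ?_) (h _ hle)
    rw [Real.norm_eq_abs, Real.norm_eq_abs, Pi.sub_apply]
    change |c * (φ : X → ℝ) x - _| ≤ _
    by_cases hxC : x ∈ C
    · simp [hφ1 x hxC, hCs hxC]
    have h2 : |c * (φ : X → ℝ) x| ≤ |c| := by
      rw [abs_mul, abs_of_nonneg (h0 x)]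
      exact mul_le_of_le_one_right (abs_nonneg _) (h1 x)
    have h3 : |c * (φ : X → ℝ) x - c| ≤ |c| := by
      have : c * (φ : X → ℝ) x - c = c * ((φ : X → ℝ) x - 1) := by ring
      rw [this, abs_mul]
      exact mul_le_of_le_one_right (abs_nonneg _)
        (abs_le.2 ⟨by linarith [h0 x], by linarith [h1 x]⟩)
    by_cases hxs : x ∈ s
    · simpa [hxs, hxC] using h3
    · by_cases hxU : x ∈ U
      · simpa [hxs, hxU, hxC] using h2
      · have : (φ : X → ℝ) x = 0 := image_eq_zero_of_notMem_tsupport fun h => hxU (hφU h)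
        simp [hxs, hxU, this]
  · rintro _ _ ⟨f, rfl⟩ ⟨g, rfl⟩
    exact ⟨f + g, rfl⟩
  · rintro _ ⟨f, rfl⟩
    exact (LipC.continuous f).aestronglyMeasurable

end Density

/-! ### The space of Borel coefficients. -/

/-- The bounded Borel functions with compact support. -/
def BorelC (X : Type*) [MetricSpace X] [MeasurableSpace X] : Submodule ℝ (X → ℝ) where
  carrier := {β | IsBoundedBorelC β}
  zero_mem' := ⟨measurable_const, ⟨0, fun x => by simp⟩, HasCompactSupport.zero⟩
  add_mem' := by
    rintro f g ⟨hf, ⟨A, hA⟩, hf'⟩ ⟨hg, ⟨B, hB⟩, hg'⟩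
    exact ⟨hf.add hg, ⟨A + B, fun x => (abs_add_le _ _).trans (add_le_add (hA x) (hB x))⟩,
      hf'.add hg'⟩
  smul_mem' := by
    rintro c f ⟨hf, ⟨A, hA⟩, hf'⟩
    refine ⟨hf.const_smul c, ⟨|c| * A, fun x => ?_⟩, hf'.smul_left (f := fun _ => c)⟩
    rw [Pi.smul_apply, smul_eq_mul, abs_mul]
    exact mul_le_mul_of_nonneg_left (hA x) (abs_nonneg _)

namespace BorelC

variable {X : Type*} [MetricSpace X] [MeasurableSpace X]

theorem indicator_mem {B : Set X} (hB : MeasurableSet B) (β : BorelC X) :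
    B.indicator (β : X → ℝ) ∈ BorelC X := by
  obtain ⟨hβ, ⟨A, hA⟩, hs⟩ := β.2
  refine ⟨hβ.indicator hB, ⟨A, fun x => ?_⟩, hs.mono fun x hx hx' => hx ?_⟩
  · by_cases hx : x ∈ B
    · simpa [hx] using hA x
    · simpa [hx] using (abs_nonneg _).trans (hA x)
  · simp [Set.indicator, hx']

/-- Restriction of a coefficient to a Borel set. -/
noncomputable def restrict (B : Set X) (hB : MeasurableSet B) : BorelC X →ₗ[ℝ] BorelC X where
  toFun β := ⟨B.indicator (β : X → ℝ), indicator_mem hB β⟩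
  map_add' _ _ := Subtype.ext (Set.indicator_add _ _ _)
  map_smul' c β := Subtype.ext (Set.indicator_const_smul B c (β : X → ℝ))

theorem restrict_apply (B : Set X) (hB : MeasurableSet B) (β : BorelC X) :
    (restrict B hB β : X → ℝ) = B.indicator (β : X → ℝ) := rfl

theorem integrable [BorelSpace X] (β : BorelC X) (M : Measure X) [IsFiniteMeasureOnCompacts M] :
    Integrable (β : X → ℝ) M := by
  obtain ⟨hβ, ⟨A, hA⟩, hs⟩ := β.2
  have hon : IntegrableOn (β : X → ℝ) (tsupport (β : X → ℝ)) M :=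
    Measure.integrableOn_of_bounded (M := A) (hs.measure_lt_top).ne hβ.aestronglyMeasurable
      (Eventually.of_forall hA)
  exact (integrableOn_iff_integrable_of_support_subset (subset_tsupport _)).1 hon

end BorelC

/-- Lipschitz functions with compact support are bounded Borel functions. -/
def LipC.toBorelC {X : Type*} [MetricSpace X] [MeasurableSpace X] [BorelSpace X] (f : LipC X) :
    BorelC X :=
  ⟨f, (LipC.continuous f).measurable,
    (LipC.continuous f).bounded_above_of_compact_support f.2.2, f.2.2⟩

theorem LipC.integrable {X : Type*} [MetricSpace X] [MeasurableSpace X] [BorelSpace X] (f : LipC X)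
    (M : Measure X) [IsFiniteMeasureOnCompacts M] : Integrable (f : X → ℝ) M :=
  (LipC.continuous f).integrable_of_hasCompactSupport f.2.2

theorem LipC.locallyLipschitz {X : Type*} [MetricSpace X] (f : LipC X) :
    LocallyLipschitz (f : X → ℝ) := by
  obtain ⟨⟨L, hL⟩, -⟩ := f.2
  exact hL.locallyLipschitz

/-! ### Extension of a current to Borel coefficients. -/

section Extension

variable {X : Type*} [MetricSpace X] [MeasurableSpace X] [BorelSpace X] {k : ℕ}
  {T : MetricCurrent k X}

theorem MetricCurrent.HasValue.unique {β : X → ℝ} {g : Fin k → LipLoc X} {s t : ℝ}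
    (hs : T.HasValue β g s) (ht : T.HasValue β g t) : s = t := by
  obtain ⟨f, hf⟩ := hs.1
  exact tendsto_nhds_unique (hs.2 f hf) (ht.2 f hf)

theorem MetricCurrent.approxInL1_iff (hT : T.HasLocallyFiniteMass) {f : ℕ → LipC X} {β : BorelC X} :
    T.ApproxInL1 f β ↔ (∃ K : Set X, IsCompact K ∧ ∀ n, tsupport (f n : X → ℝ) ⊆ K) ∧
      Tendsto (fun n => ∫ x, |(f n : X → ℝ) x - (β : X → ℝ) x| ∂massMeasure T.toFun)
        atTop (𝓝 0) := by
  have := hT.isFiniteMeasureOnCompacts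
  refine and_congr_right fun _ => ?_
  have h : ∀ n, ∫⁻ x, ENNReal.ofReal |(f n : X → ℝ) x - (β : X → ℝ) x| ∂massMeasure T.toFun =
      ENNReal.ofReal (∫ x, |(f n : X → ℝ) x - (β : X → ℝ) x| ∂massMeasure T.toFun) := fun n =>
    (ofReal_integral_eq_lintegral_ofReal
      (((LipC.integrable (f n) _).sub (BorelC.integrable β _)).abs)
      (Eventually.of_forall fun _ => abs_nonneg _)).symm
  simp_rw [h]
  constructor
  · intro h
    have := (ENNReal.tendsto_toReal ENNReal.zero_ne_top).comp h
    refine this.congr fun n => ?_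
    exact ENNReal.toReal_ofReal (integral_nonneg fun _ => abs_nonneg _)
  · intro h
    simpa using ENNReal.tendsto_ofReal h

variable [LocallyCompactSpace X]

/-- The mass bound for `f - f'`. It gives the Cauchy property of the values along an approximation
of `β` and the independence of the limit from the approximation. -/
theorem MetricCurrent.abs_toFun_sub_le (hT : T.HasLocallyFiniteMass) {K : Set X} {L : Fin k → ℝ≥0}
    {g : Fin k → LipLoc X} (hg : ∀ i, LipschitzOnWith (L i) (g i : X → ℝ) K) (β : BorelC X)
    {f f' : LipC X} (hf : tsupport (f : X → ℝ) ⊆ K) (hf' : tsupport (f' : X → ℝ) ⊆ K) :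
    |T.toFun f g - T.toFun f' g| ≤ (∏ i, (L i : ℝ)) *
      ((∫ x, |(f : X → ℝ) x - (β : X → ℝ) x| ∂massMeasure T.toFun) +
        ∫ x, |(f' : X → ℝ) x - (β : X → ℝ) x| ∂massMeasure T.toFun) := by
  have := hT.isFiniteMeasureOnCompacts
  have hs : tsupport ((f - f' : LipC X) : X → ℝ) ⊆ K :=
    (tsupport_sub (f : X → ℝ) (f' : X → ℝ)).trans (Set.union_subset hf hf')
  have hi := ((LipC.integrable f (massMeasure T.toFun)).sub (BorelC.integrable β _)).abs
  have hi' := ((LipC.integrable f' (massMeasure T.toFun)).sub (BorelC.integrable β _)).abs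
  calc |T.toFun f g - T.toFun f' g| = |T.toFun (f - f') g| := by rw [map_sub, sub_apply]
    _ ≤ _ := T.abs_le_prod_mul_integral hT fun i => (hg i).mono hs
    _ ≤ _ := by
      refine mul_le_mul_of_nonneg_left ?_ (Finset.prod_nonneg fun i _ => (L i).coe_nonneg)
      refine le_trans (integral_mono (LipC.integrable (f - f') _).abs (hi.add hi')
        fun x => ?_) (integral_add hi hi').le
      change |(f : X → ℝ) x - (f' : X → ℝ) x| ≤ |_ - (β : X → ℝ) x| + |_ - (β : X → ℝ) x|
      rw [abs_sub_comm ((f' : X → ℝ) x)]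
      exact abs_sub_le _ _ _

theorem MetricCurrent.tendsto_sub_of_approxInL1 (hT : T.HasLocallyFiniteMass)
    (g : Fin k → LipLoc X) {β : BorelC X} {f f' : ℕ → LipC X} (hf : T.ApproxInL1 f β)
    (hf' : T.ApproxInL1 f' β) :
    Tendsto (fun n => T.toFun (f n) g - T.toFun (f' n) g) atTop (𝓝 0) := by
  obtain ⟨⟨K, hK, hfK⟩, h⟩ := (T.approxInL1_iff hT).1 hf
  obtain ⟨⟨K', hK', hfK'⟩, h'⟩ := (T.approxInL1_iff hT).1 hf'
  choose L hL using fun i => LipLoc.exists_lipschitzOnWith (g i) (hK.union hK')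
  refine squeeze_zero_norm (fun n => T.abs_toFun_sub_le hT hL β
    ((hfK n).trans Set.subset_union_left) ((hfK' n).trans Set.subset_union_right)) ?_
  simpa using (h.add h').const_mul (∏ i, (L i : ℝ))

theorem MetricCurrent.hasValue_of_tendsto (hT : T.HasLocallyFiniteMass)
    {g : Fin k → LipLoc X} {β : BorelC X} {f : ℕ → LipC X} (hf : T.ApproxInL1 f β) {t : ℝ}
    (ht : Tendsto (fun n => T.toFun (f n) g) atTop (𝓝 t)) : T.HasValue β g t :=
  ⟨⟨f, hf⟩, fun f' hf' => by
    simpa using ht.add (T.tendsto_sub_of_approxInL1 hT g hf' hf)⟩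

variable [TopologicalSpace.SeparableSpace X]

theorem MetricCurrent.HasLocallyFiniteMass.regular (hT : T.HasLocallyFiniteMass) :
    (massMeasure T.toFun).Regular := by
  have := hT.isFiniteMeasureOnCompacts
  have := UniformSpace.secondCountable_of_separable X
  infer_instance

/-- The approximations may be taken with supports near the support of the coefficient. -/
theorem MetricCurrent.exists_approxInL1_tsupport_subset (hT : T.HasLocallyFiniteMass)
    (β : BorelC X) {U : Set X} (hU : IsOpen U) (hβU : tsupport (β : X → ℝ) ⊆ U) :
    ∃ f : ℕ → LipC X, T.ApproxInL1 f β ∧ ∀ n, tsupport (f n : X → ℝ) ⊆ U := by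
  have := hT.isFiniteMeasureOnCompacts
  have := hT.regular
  set M := massMeasure T.toFun
  -- Density gives no control of supports. Multiplying by a cutoff equal to `1` on the support of
  -- `β` provides it without increasing the distance to `β`.
  obtain ⟨φ, h0, h1, hφ1, hφU⟩ := exists_LipC_cutoff β.2.2.2 hU hβU
  have hex : ∀ n : ℕ, ∃ f : LipC X, ∫ x, |(f : X → ℝ) x - (β : X → ℝ) x| ∂M ≤ 1 / ((n : ℝ) + 1) := by
    intro n
    have hpos : (0 : ℝ) < 1 / ((n : ℝ) + 1) := by positivity
    obtain ⟨f, hf⟩ := exists_LipC_eLpNorm_sub_le (memLp_one_iff_integrable.2 (BorelC.integrable β M))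
      (ε := ENNReal.ofReal (1 / ((n : ℝ) + 1))) (by simpa using hpos)
    refine ⟨f, ?_⟩
    rw [eLpNorm_one_eq_lintegral_enorm,
      ← ofReal_integral_norm_eq_lintegral_enorm ((BorelC.integrable β M).sub (LipC.integrable f M)),
      ENNReal.ofReal_le_ofReal_iff hpos.le] at hf
    refine le_trans (le_of_eq (integral_congr_ae (Eventually.of_forall fun x => ?_))) hf
    exact abs_sub_comm _ _
  choose f hf using hex
  refine ⟨fun n => ⟨_, locallyLipschitz_mul_mem_LipC
    (LipC.locallyLipschitz φ) (f n)⟩, (T.approxInL1_iff hT).2 ⟨?_, ?_⟩, fun n => ?_⟩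
  · exact ⟨_, φ.2.2, fun n => tsupport_mul_subset_left⟩
  · refine squeeze_zero (fun n => integral_nonneg fun _ => abs_nonneg _) (fun n => ?_)
      tendsto_one_div_add_atTop_nhds_zero_nat
    refine (integral_mono_of_nonneg (Eventually.of_forall fun _ => abs_nonneg _)
      (LipC.integrable (f n) M |>.sub (BorelC.integrable β M)).abs
      (Eventually.of_forall fun x => ?_)).trans (hf n)
    change |(φ : X → ℝ) x * (f n : X → ℝ) x - (β : X → ℝ) x| ≤
      |(f n : X → ℝ) x - (β : X → ℝ) x|
    have : (φ : X → ℝ) x * (f n : X → ℝ) x - (β : X → ℝ) x =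
        (φ : X → ℝ) x * ((f n : X → ℝ) x - (β : X → ℝ) x) := by
      by_cases hx : x ∈ tsupport (β : X → ℝ)
      · simp [hφ1 x hx]
      · simp [image_eq_zero_of_notMem_tsupport hx]
    rw [this, abs_mul, abs_of_nonneg (h0 x)]
    exact mul_le_of_le_one_left (abs_nonneg _) (h1 x)
  · exact tsupport_mul_subset_left.trans hφU

theorem MetricCurrent.exists_hasValue (hT : T.HasLocallyFiniteMass) (β : BorelC X)
    (g : Fin k → LipLoc X) : ∃ t, T.HasValue β g t := by
  obtain ⟨f, hf, -⟩ := T.exists_approxInL1_tsupport_subset hT β isOpen_univ (Set.subset_univ _)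
  obtain ⟨⟨K, hK, hfK⟩, h⟩ := (T.approxInL1_iff hT).1 hf
  choose L hL using fun i => LipLoc.exists_lipschitzOnWith (g i) hK
  have hC : Tendsto (fun n => (∏ i, (L i : ℝ)) *
      ∫ x, |(f n : X → ℝ) x - (β : X → ℝ) x| ∂massMeasure T.toFun) atTop (𝓝 0) := by
    simpa using h.const_mul (∏ i, (L i : ℝ))
  have hcauchy : CauchySeq fun n => T.toFun (f n) g := by
    refine Metric.cauchySeq_iff.2 fun ε hε => ?_
    obtain ⟨N, hN⟩ := eventually_atTop.1 (hC.eventually_lt_const (half_pos hε))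
    refine ⟨N, fun m hm n hn => ?_⟩
    refine (T.abs_toFun_sub_le hT hL β (hfK m) (hfK n)).trans_lt ?_
    have h1 := hN m hm
    have h2 := hN n hn
    rw [mul_add]
    linarith
  obtain ⟨t, ht⟩ := cauchySeq_tendsto_of_complete hcauchy
  exact ⟨t, T.hasValue_of_tendsto hT hf ht⟩

/-- The value of the extended current on `β dg¹ ∧ … ∧ dgᵏ`. -/
noncomputable def MetricCurrent.borelValue (hT : T.HasLocallyFiniteMass) (β : BorelC X)
    (g : Fin k → LipLoc X) : ℝ :=
  (T.exists_hasValue hT β g).choose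

theorem MetricCurrent.hasValue_borelValue (hT : T.HasLocallyFiniteMass) (β : BorelC X)
    (g : Fin k → LipLoc X) : T.HasValue β g (T.borelValue hT β g) :=
  (T.exists_hasValue hT β g).choose_spec

theorem MetricCurrent.borelValue_add (hT : T.HasLocallyFiniteMass) (β γ : BorelC X)
    (g : Fin k → LipLoc X) :
    T.borelValue hT (β + γ) g = T.borelValue hT β g + T.borelValue hT γ g := by
  have := hT.isFiniteMeasureOnCompacts
  have hβ := T.hasValue_borelValue hT β g
  have hγ := T.hasValue_borelValue hT γ g
  obtain ⟨a, ha⟩ := hβ.1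
  obtain ⟨b, hb⟩ := hγ.1
  have hlim := (hβ.2 a ha).add (hγ.2 b hb)
  obtain ⟨⟨K, hK, haK⟩, ha'⟩ := (T.approxInL1_iff hT).1 ha
  obtain ⟨⟨K', hK', hbK⟩, hb'⟩ := (T.approxInL1_iff hT).1 hb
  refine (T.hasValue_borelValue hT (β + γ) g).unique
    (T.hasValue_of_tendsto hT (f := fun n => a n + b n) ((T.approxInL1_iff hT).2 ⟨?_, ?_⟩) ?_)
  · exact ⟨_, hK.union hK', fun n => (tsupport_add (a n : X → ℝ) (b n : X → ℝ)).trans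
      (Set.union_subset_union (haK n) (hbK n))⟩
  · refine squeeze_zero (fun n => integral_nonneg fun _ => abs_nonneg _) (fun n => ?_)
      (by simpa using ha'.add hb')
    have hi := ((LipC.integrable (a n) (massMeasure T.toFun)).sub (BorelC.integrable β _)).abs
    have hi' := ((LipC.integrable (b n) (massMeasure T.toFun)).sub (BorelC.integrable γ _)).abs
    refine le_trans (integral_mono_of_nonneg (Eventually.of_forall fun _ => abs_nonneg _)
      (hi.add hi') (Eventually.of_forall fun x => ?_)) (integral_add hi hi').le
    change |((a n : X → ℝ) x + (b n : X → ℝ) x) - ((β : X → ℝ) x + (γ : X → ℝ) x)| ≤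
      |(a n : X → ℝ) x - (β : X → ℝ) x| + |(b n : X → ℝ) x - (γ : X → ℝ) x|
    rw [add_sub_add_comm]
    exact abs_add_le _ _
  · simpa only [map_add, add_apply] using hlim

theorem MetricCurrent.borelValue_smul (hT : T.HasLocallyFiniteMass) (c : ℝ) (β : BorelC X)
    (g : Fin k → LipLoc X) : T.borelValue hT (c • β) g = c * T.borelValue hT β g := by
  have hβ := T.hasValue_borelValue hT β g
  obtain ⟨a, ha⟩ := hβ.1
  have hlim := (hβ.2 a ha).const_mul c
  obtain ⟨⟨K, hK, haK⟩, ha'⟩ := (T.approxInL1_iff hT).1 ha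
  refine (T.hasValue_borelValue hT (c • β) g).unique
    (T.hasValue_of_tendsto hT (f := fun n => c • a n) ((T.approxInL1_iff hT).2 ⟨?_, ?_⟩) ?_)
  · exact ⟨_, hK, fun n => (closure_mono (Function.support_const_smul_subset _ _)).trans (haK n)⟩
  · have : ∀ n, ∫ x, |((c • a n : LipC X) : X → ℝ) x - ((c • β : BorelC X) : X → ℝ) x|
        ∂massMeasure T.toFun =
        |c| * ∫ x, |(a n : X → ℝ) x - (β : X → ℝ) x| ∂massMeasure T.toFun := by
      intro n
      rw [← integral_const_mul]
      congr 1
      funext x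
      change |c * (a n : X → ℝ) x - c * (β : X → ℝ) x| = _
      rw [← mul_sub, abs_mul]
    simp_rw [this]
    simpa using ha'.const_mul |c|
  · simpa only [map_smul, smul_apply, smul_eq_mul] using hlim

/-- The extension of a current of locally finite mass to bounded Borel coefficients with compact
support. -/
noncomputable def MetricCurrent.borelExtension (hT : T.HasLocallyFiniteMass) :
    BorelC X →ₗ[ℝ] MultilinearMap ℝ (fun _ : Fin k => LipLoc X) ℝ where
  toFun β :=
    { toFun := T.borelValue hT β
      map_update_add' := fun {inst} g i x y => by
        obtain rfl : inst = instDecidableEqFin k := Subsingleton.elim _ _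
        obtain ⟨f, hf⟩ := (T.hasValue_borelValue hT β g).1
        -- Approximating `β` does not involve `g`, so one sequence computes the values at all `g`,
        -- and multilinearity passes to the limit.
        have h := fun g => (T.hasValue_borelValue hT β g).2 f hf
        refine tendsto_nhds_unique (h _) ?_
        simp_rw [MultilinearMap.map_update_add]
        exact (h _).add (h _)
      map_update_smul' := fun {inst} g i c x => by
        obtain rfl : inst = instDecidableEqFin k := Subsingleton.elim _ _
        obtain ⟨f, hf⟩ := (T.hasValue_borelValue hT β g).1
        have h := fun g => (T.hasValue_borelValue hT β g).2 f hf
        refine tendsto_nhds_unique (h _) ?_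
        simp_rw [MultilinearMap.map_update_smul]
        exact (h _).const_smul c }
  map_add' β γ := MultilinearMap.ext fun g => T.borelValue_add hT β γ g
  map_smul' c β := MultilinearMap.ext fun g => T.borelValue_smul hT c β g

theorem MetricCurrent.hasValue_borelExtension (hT : T.HasLocallyFiniteMass) (β : BorelC X)
    (g : Fin k → LipLoc X) : T.HasValue β g (T.borelExtension hT β g) :=
  T.hasValue_borelValue hT β g

theorem MetricCurrent.borelExtension_toBorelC (hT : T.HasLocallyFiniteMass) (f : LipC X)
    (g : Fin k → LipLoc X) : T.borelExtension hT (LipC.toBorelC f) g = T.toFun f g := by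
  refine tendsto_nhds_unique ((T.hasValue_borelExtension hT (LipC.toBorelC f) g).2 (fun _ => f) ?_)
    tendsto_const_nhds
  exact (T.approxInL1_iff hT).2 ⟨⟨_, f.2.2, fun _ => subset_rfl⟩, by simp [LipC.toBorelC]⟩

end Extension

/-! ### Mass bound, continuity and locality for Borel coefficients. -/

section Bounds

variable {X : Type*} [MetricSpace X] [MeasurableSpace X] [BorelSpace X] [LocallyCompactSpace X]
  [TopologicalSpace.SeparableSpace X] {k : ℕ} {T : MetricCurrent k X}

/-- Approximating functions supported in `interior K` see only the Lipschitz constants on `K`. This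
preliminary bound needs room around the support of `β`; locality removes that restriction in
`MetricCurrent.abs_borelExtension_le`. -/
theorem MetricCurrent.abs_borelExtension_le_of_interior (hT : T.HasLocallyFiniteMass)
    {β : BorelC X} {K : Set X} (hK : tsupport (β : X → ℝ) ⊆ interior K) {g : Fin k → LipLoc X}
    {L : Fin k → ℝ≥0} (hg : ∀ i, LipschitzOnWith (L i) (g i : X → ℝ) K) :
    |T.borelExtension hT β g| ≤
      (∏ i, (L i : ℝ)) * ∫ x, |(β : X → ℝ) x| ∂massMeasure T.toFun := by
  have := hT.isFiniteMeasureOnCompacts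
  obtain ⟨f, hf, hfK⟩ := T.exists_approxInL1_tsupport_subset hT β isOpen_interior hK
  have h := ((T.hasValue_borelExtension hT β g).2 f hf).abs
  have h0 := ((T.approxInL1_iff hT).1 hf).2
  have hlim := (h0.const_add (∫ x, |(β : X → ℝ) x| ∂massMeasure T.toFun)).const_mul
    (∏ i, (L i : ℝ))
  rw [add_zero] at hlim
  refine le_of_tendsto_of_tendsto' h hlim fun n => ?_
  refine (T.abs_le_prod_mul_integral hT fun i =>
    (hg i).mono ((hfK n).trans interior_subset)).trans ?_
  refine mul_le_mul_of_nonneg_left ?_ (Finset.prod_nonneg fun i _ => (L i).coe_nonneg)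
  have hi := (BorelC.integrable β (massMeasure T.toFun)).abs
  have hi' := ((LipC.integrable (f n) (massMeasure T.toFun)).sub (BorelC.integrable β _)).abs
  refine le_trans (integral_mono (LipC.integrable (f n) _).abs (hi.add hi') fun x => ?_)
    (integral_add hi hi').le
  change |(f n : X → ℝ) x| ≤ |(β : X → ℝ) x| + |(f n : X → ℝ) x - (β : X → ℝ) x|
  have := abs_add_le ((β : X → ℝ) x) ((f n : X → ℝ) x - (β : X → ℝ) x)
  simpa using this

/-- Sequential continuity of the extension in the functions `gⁱ`. -/
theorem MetricCurrent.tendsto_borelExtension (hT : T.HasLocallyFiniteMass) (β : BorelC X)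
    {g : ℕ → Fin k → LipLoc X} {g₀ : Fin k → LipLoc X}
    (hg : ∀ i, LipLocConverges (fun n => g n i) (g₀ i)) :
    Tendsto (fun n => T.borelExtension hT β (g n)) atTop (𝓝 (T.borelExtension hT β g₀)) := by
  obtain ⟨K, hK, hβK⟩ := exists_compact_superset β.2.2.2
  choose L hL₀ hL using fun i => (hg i).2 K hK
  obtain ⟨f, hf, hfK⟩ := T.exists_approxInL1_tsupport_subset hT β isOpen_interior hβK
  have h0 := (((T.approxInL1_iff hT).1 hf).2).const_mul (∏ i, (L i : ℝ))
  rw [mul_zero] at h0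
  -- The error of replacing `β` by `f m` is uniform over all `G` with the common Lipschitz
  -- constants, hence over the whole sequence `g n`. The axiom of continuity is then needed for a
  -- single Lipschitz coefficient.
  have bound : ∀ (m : ℕ) (G : Fin k → LipLoc X),
      (∀ i, LipschitzOnWith (L i) (G i : X → ℝ) K) →
      |T.toFun (f m) G - T.borelExtension hT β G| ≤ (∏ i, (L i : ℝ)) *
        ∫ x, |(f m : X → ℝ) x - (β : X → ℝ) x| ∂massMeasure T.toFun := by
    intro m G hG
    have hs : tsupport ((LipC.toBorelC (f m) - β : BorelC X) : X → ℝ) ⊆ interior K :=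
      (tsupport_sub (f m : X → ℝ) (β : X → ℝ)).trans (Set.union_subset (hfK m) hβK)
    rw [← T.borelExtension_toBorelC hT, ← sub_apply, ← map_sub]
    exact T.abs_borelExtension_le_of_interior hT hs hG
  refine Metric.tendsto_atTop.2 fun ε hε => ?_
  obtain ⟨m, hm⟩ := (h0.eventually_lt_const (show 0 < ε / 3 by positivity)).exists
  have hcont := T.continuity (fun _ => f m) (f m) g g₀
    ⟨fun _ => tendsto_const_nhds, ?_, _, (f m).2.2, subset_rfl, fun _ => subset_rfl⟩ hg
  · obtain ⟨N, hN⟩ := Metric.tendsto_atTop.1 hcont (ε / 3) (by positivity)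
    refine ⟨N, fun n hn => ?_⟩
    have h1 := (bound m (g n) fun i => hL i n).trans_lt hm
    have h2 := (bound m g₀ hL₀).trans_lt hm
    have h3 := hN n hn
    rw [Real.dist_eq] at h3 ⊢
    rw [abs_lt] at h1 h2 h3 ⊢
    constructor <;> linarith [h1.1, h1.2, h2.1, h2.2, h3.1, h3.2]
  · obtain ⟨⟨A, hA⟩, -⟩ := (f m).2
    exact ⟨A, hA, fun _ => hA⟩

theorem lipLocConverges_const {X : Type*} [MetricSpace X] (g : LipLoc X) :
    LipLocConverges (fun _ => g) g :=
  ⟨fun _ => tendsto_const_nhds, fun _ hK => by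
    obtain ⟨L, hL⟩ := LipLoc.exists_lipschitzOnWith g hK
    exact ⟨L, hL, fun _ => hL⟩⟩

theorem lipLocConverges_update {X : Type*} [MetricSpace X] {ι : Type*} [DecidableEq ι]
    (g : ι → LipLoc X) (i : ι) {h : ℕ → LipLoc X} {h₀ : LipLoc X} (hh : LipLocConverges h h₀)
    (j : ι) : LipLocConverges (fun n => Function.update g i (h n) j) (Function.update g i h₀ j) := by
  by_cases hj : j = i
  · subst hj
    simpa using hh
  · simpa [hj] using lipLocConverges_const (g j)

theorem lipLocConverges_comp {X : Type*} [MetricSpace X] {h : LipLoc X} {φ : ℕ → ℝ → ℝ} {L : ℝ≥0}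
    (hφ : ∀ n, LipschitzWith L (φ n)) (hL : 1 ≤ L)
    (hlim : ∀ t, Tendsto (fun n => φ n t) atTop (𝓝 t)) :
    LipLocConverges (fun n => ⟨_, comp_mem_LipLoc (hφ n) h⟩) h := by
  refine ⟨fun x => hlim _, fun K hK => ?_⟩
  obtain ⟨A, hA⟩ := LipLoc.exists_lipschitzOnWith h hK
  refine ⟨L * A, hA.weaken ?_, fun n => (hφ n).comp_lipschitzOnWith hA⟩
  exact le_mul_of_one_le_left zero_le hL

theorem lipschitzWith_clamp (δ : ℝ) : LipschitzWith 1 fun t : ℝ => max (-δ) (min t δ) :=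
  (LipschitzWith.id.min_const δ).const_max (-δ)

theorem lipschitzWith_tent (δ : ℝ≥0) : LipschitzWith δ⁻¹ fun t : ℝ => max 0 (1 - |t| / δ) := by
  refine LipschitzWith.const_max (LipschitzWith.of_dist_le_mul fun x y => ?_) 0
  rw [Real.dist_eq, Real.dist_eq, sub_sub_sub_cancel_left, ← sub_div, abs_div, abs_sub_comm x y,
    NNReal.abs_eq, NNReal.coe_inv, inv_mul_eq_div]
  exact div_le_div_of_nonneg_right (abs_abs_sub_abs_le y x) δ.coe_nonneg

/-- If `gⁱ` vanishes where `β` does not, then its oscillation can be truncated. -/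
theorem MetricCurrent.borelExtension_update_clamp (hT : T.HasLocallyFiniteMass) (β : BorelC X)
    (g : Fin k → LipLoc X) (i : Fin k) (h0 : ∀ x, (β : X → ℝ) x ≠ 0 → (g i : X → ℝ) x = 0)
    {δ : ℝ≥0} (hδ : 0 < δ) :
    T.borelExtension hT β g = T.borelExtension hT β (Function.update g i
      ⟨_, comp_mem_LipLoc (lipschitzWith_clamp δ) (g i)⟩) := by
  have := hT.isFiniteMeasureOnCompacts
  have hδ' : (0 : ℝ) < δ := hδ
  obtain ⟨f, hf, -⟩ := T.exists_approxInL1_tsupport_subset hT β isOpen_univ (Set.subset_univ _)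
  obtain ⟨⟨K, hK, hfK⟩, hlim⟩ := (T.approxInL1_iff hT).1 hf
  -- This factor is `1` where `β ≠ 0` and supported where `|g i| ≤ δ`. So `u * f n` still
  -- approximates `β`, while on its support `g i` equals its truncation and locality applies.
  let u : X → ℝ := fun x => max 0 (1 - |(g i : X → ℝ) x| / δ)
  have hu : LocallyLipschitz u := comp_mem_LipLoc (lipschitzWith_tent δ) (g i)
  have hu0 : ∀ x, 0 ≤ u x := fun x => le_max_left _ _
  have hu1 : ∀ x, u x ≤ 1 := fun x =>
    max_le zero_le_one (sub_le_self _ (div_nonneg (abs_nonneg _) hδ'.le))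
  let F : ℕ → LipC X := fun n => ⟨_, locallyLipschitz_mul_mem_LipC hu (f n)⟩
  have hF : T.ApproxInL1 F β := by
    refine (T.approxInL1_iff hT).2 ⟨⟨K, hK, fun n => tsupport_mul_subset_right.trans (hfK n)⟩, ?_⟩
    refine squeeze_zero (fun n => integral_nonneg fun _ => abs_nonneg _) (fun n => ?_) hlim
    refine integral_mono_of_nonneg (Eventually.of_forall fun _ => abs_nonneg _)
      ((LipC.integrable (f n) (massMeasure T.toFun)).sub (BorelC.integrable β _)).abs
      (Eventually.of_forall fun x => ?_)
    change |u x * (f n : X → ℝ) x - (β : X → ℝ) x| ≤ |(f n : X → ℝ) x - (β : X → ℝ) x|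
    have : u x * (f n : X → ℝ) x - (β : X → ℝ) x =
        u x * ((f n : X → ℝ) x - (β : X → ℝ) x) := by
      by_cases hx : (β : X → ℝ) x = 0
      · simp [hx]
      · simp [u, h0 x hx]
    rw [this, abs_mul, abs_of_nonneg (hu0 x)]
    exact mul_le_of_le_one_left (abs_nonneg _) (hu1 x)
  have hsupp : ∀ n, ∀ x ∈ tsupport (F n : X → ℝ), |(g i : X → ℝ) x| ≤ δ := by
    intro n x hx
    have hcl : IsClosed {x | |(g i : X → ℝ) x| ≤ δ} :=
      isClosed_le (LipLoc.continuous (g i)).abs continuous_const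
    refine closure_minimal (fun y hy => ?_) hcl hx
    by_contra hlt
    simp only [Set.mem_ofPred_eq, not_le] at hlt
    apply hy
    have : u y = 0 := max_eq_left (sub_nonpos.2 ((one_le_div hδ').2 hlt.le))
    change u y * (f n : X → ℝ) y = 0
    rw [this, zero_mul]
  refine tendsto_nhds_unique ((T.hasValue_borelExtension hT β g).2 F hF)
    (((T.hasValue_borelExtension hT β _).2 F hF).congr fun n => ?_)
  have hself : T.toFun (F n) g = T.toFun (F n) (Function.update g i (g i)) := by
    rw [Function.update_eq_self]
  rw [eq_comm, ← sub_eq_zero, hself, ← MultilinearMap.map_update_sub]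
  refine T.locality (F n) _ i 0 fun x hx => ?_
  rw [Function.update_self]
  change (g i : X → ℝ) x - max (-(δ : ℝ)) (min ((g i : X → ℝ) x) δ) = 0
  have := abs_le.1 (hsupp n x hx)
  rw [min_eq_left this.2, max_eq_right this.1, sub_self]

/-- Locality for Borel coefficients. -/
theorem MetricCurrent.borelExtension_eq_zero_of_eq_zero (hT : T.HasLocallyFiniteMass)
    (β : BorelC X) (g : Fin k → LipLoc X) (i : Fin k)
    (h0 : ∀ x, (β : X → ℝ) x ≠ 0 → (g i : X → ℝ) x = 0) : T.borelExtension hT β g = 0 := by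
  let δ : ℕ → ℝ≥0 := fun n => 1 / ((n : ℝ≥0) + 1)
  have hδ : ∀ n, 0 < δ n := fun n => by positivity
  -- Truncating at `δ n → 0` sends `g i` to `0` pointwise without increasing its Lipschitz
  -- constants, so continuity forces the common value to be `0`.
  have hconv : LipLocConverges (fun n =>
      (⟨_, comp_mem_LipLoc (lipschitzWith_clamp (δ n)) (g i)⟩ : LipLoc X)) 0 := by
    refine ⟨fun x => ?_, fun K hK => ?_⟩
    · refine squeeze_zero_norm (fun n => ?_) tendsto_one_div_add_atTop_nhds_zero_nat
      change |max (-(δ n : ℝ)) (min ((g i : X → ℝ) x) (δ n))| ≤ _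
      have hn : (δ n : ℝ) = 1 / ((n : ℝ) + 1) := by simp [δ]
      have h0 : (0 : ℝ) ≤ δ n := (δ n).coe_nonneg
      rw [← hn]
      exact abs_le.2 ⟨le_max_left _ _, max_le (by linarith) (min_le_right _ _)⟩
    · obtain ⟨L, hL⟩ := LipLoc.exists_lipschitzOnWith (g i) hK
      refine ⟨L, (LipschitzWith.const' 0).lipschitzOnWith, fun n => ?_⟩
      have := (lipschitzWith_clamp (δ n)).comp_lipschitzOnWith hL
      rw [one_mul] at this
      exact this
  have hlim := T.tendsto_borelExtension hT β (lipLocConverges_update g i hconv)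
  rw [MultilinearMap.map_update_zero] at hlim
  refine tendsto_nhds_unique (tendsto_const_nhds.congr fun n => ?_) hlim
  exact T.borelExtension_update_clamp hT β g i h0 (hδ n)

/-- The entries are exchanged one at a time; each difference has an entry vanishing where `β` does
not. -/
theorem MetricCurrent.borelExtension_congr (hT : T.HasLocallyFiniteMass) (β : BorelC X)
    {g g' : Fin k → LipLoc X}
    (h : ∀ i x, (β : X → ℝ) x ≠ 0 → (g i : X → ℝ) x = (g' i : X → ℝ) x) :
    T.borelExtension hT β g = T.borelExtension hT β g' := by
  suffices H : ∀ s : Finset (Fin k),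
      T.borelExtension hT β (s.piecewise g' g) = T.borelExtension hT β g by
    rw [← H Finset.univ, Finset.piecewise_univ]
  intro s
  induction s using Finset.induction_on with
  | empty => simp
  | insert j s hj ih =>
    have hself : T.borelExtension hT β (s.piecewise g' g) = T.borelExtension hT β
        (Function.update (s.piecewise g' g) j (s.piecewise g' g j)) := by
      rw [Function.update_eq_self]
    rw [← ih, Finset.piecewise_insert, ← sub_eq_zero, hself, ← MultilinearMap.map_update_sub]
    refine T.borelExtension_eq_zero_of_eq_zero hT β _ j fun x hx => ?_
    rw [Function.update_self, Finset.piecewise_eq_of_notMem _ _ _ hj]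
    exact sub_eq_zero.2 (h j x hx).symm

/-- The mass bound for Borel coefficients: only the Lipschitz constants of the `gⁱ` on a set
carrying the coefficient matter. -/
theorem MetricCurrent.abs_borelExtension_le (hT : T.HasLocallyFiniteMass) {β : BorelC X}
    {B : Set X} (hB : ∀ x, (β : X → ℝ) x ≠ 0 → x ∈ B) {g : Fin k → LipLoc X} {L : Fin k → ℝ≥0}
    (hg : ∀ i, LipschitzOnWith (L i) (g i : X → ℝ) B) :
    |T.borelExtension hT β g| ≤
      (∏ i, (L i : ℝ)) * ∫ x, |(β : X → ℝ) x| ∂massMeasure T.toFun := by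
  -- A real Lipschitz function on `B` extends to all of `X` with the same constant, and locality
  -- allows the exchange although `B` may have empty interior.
  choose G hG hGg using fun i => (hg i).extend_real
  have hcongr : T.borelExtension hT β g =
      T.borelExtension hT β fun i => ⟨G i, (hG i).locallyLipschitz⟩ :=
    T.borelExtension_congr hT β fun i x hx => hGg i (hB x hx)
  rw [hcongr]
  exact T.abs_borelExtension_le_of_interior hT (K := Set.univ) (by simp)
    fun i => (hG i).lipschitzOnWith

end Bounds

/-! ### Set functions and countable covers. -/

section Cover

/-- An additive set function dominated by a finite measure is controlled by its behaviour on the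
pieces of a countable cover. -/
theorem abs_le_mul_measureReal_of_cover {X : Type*} [MeasurableSpace X] {m : Measure X}
    [IsFiniteMeasure m] {ν : ∀ B : Set X, MeasurableSet B → ℝ}
    (hadd : ∀ A B (hA : MeasurableSet A) (hB : MeasurableSet B), Disjoint A B →
      ν (A ∪ B) (hA.union hB) = ν A hA + ν B hB)
    {C ε : ℝ} (hC : ∀ B hB, |ν B hB| ≤ C * m.real B)
    {ι : Type*} [Countable ι] {P : ι → Set X} (hP : ∀ j, MeasurableSet (P j))
    (hcov : m (⋃ j, P j)ᶜ = 0) (hε : ∀ j B hB, B ⊆ P j → |ν B hB| ≤ ε * m.real B) :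
    |ν Set.univ MeasurableSet.univ| ≤ ε * m.real Set.univ := by
  rcases isEmpty_or_nonempty ι with hι | hι
  · have h0 : m.real Set.univ = 0 := by
      rw [Set.iUnion_of_empty, Set.compl_empty] at hcov
      simp [Measure.real, hcov]
    have := hC _ MeasurableSet.univ
    rw [h0, mul_zero] at this ⊢
    exact this
  obtain ⟨e, he⟩ := exists_surjective_nat ι
  let U : ℕ → Set X := fun n => ⋃ j ∈ Finset.range n, P (e j)
  have hUm : ∀ n, MeasurableSet (U n) := fun n =>
    Finset.measurableSet_biUnion _ fun j _ => hP (e j)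
  have hsplit : ∀ A B (hA : MeasurableSet A) (hB : MeasurableSet B),
      ν B hB = ν (B ∩ A) (hB.inter hA) + ν (B \ A) (hB.diff hA) := by
    intro A B hA hB
    rw [← hadd _ _ _ _ Set.disjoint_sdiff_inter.symm]
    congr 1
    exact (Set.inter_union_sdiff B A).symm
  -- Finite additivity suffices on finite unions of pieces. What remains has measure tending to `0`,
  -- and there the crude bound with `C` is enough.
  have hUε : ∀ n B hB, B ⊆ U n → |ν B hB| ≤ ε * m.real B := by
    intro n
    induction n with
    | zero =>
      intro B hB hBU
      have hBe : B = ∅ := by simpa [U] using hBU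
      have := hC B hB
      simp only [hBe, measureReal_empty, mul_zero] at this ⊢
      exact this
    | succ n ih =>
      intro B hB hBU
      have h1 := ih (B ∩ U n) (hB.inter (hUm n)) Set.inter_subset_right
      have h2 := hε (e n) (B \ U n) (hB.diff (hUm n)) (by
        rintro x ⟨hx, hxn⟩
        have := hBU hx
        simp only [U, Finset.range_add_one, Finset.set_biUnion_insert] at this hxn
        exact this.resolve_right hxn)
      rw [hsplit (U n) B (hUm n) hB, ← measureReal_inter_add_sdiff (μ := m) (hUm n), mul_add]
      exact (abs_add_le _ _).trans (add_le_add h1 h2)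
  have hanti : Antitone fun n => (U n)ᶜ := fun a b hab => Set.compl_subset_compl.2
    (Set.biUnion_subset_biUnion_left fun j hj =>
      Finset.mem_range.2 ((Finset.mem_range.1 hj).trans_le hab))
  have hInter : ⋂ n, (U n)ᶜ ⊆ (⋃ j, P j)ᶜ := by
    intro x hx hx'
    obtain ⟨j, hj⟩ := Set.mem_iUnion.1 hx'
    obtain ⟨n, rfl⟩ := he j
    exact Set.mem_iInter.1 hx (n + 1) (Set.mem_biUnion (Finset.self_mem_range_succ n) hj)
  have hlim : Tendsto (fun n => m.real (U n)ᶜ) atTop (𝓝 0) := by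
    have := tendsto_measure_iInter_atTop (μ := m) (s := fun n => (U n)ᶜ)
      (fun n => (hUm n).compl.nullMeasurableSet) hanti ⟨0, measure_ne_top _ _⟩
    rw [measure_mono_null hInter hcov] at this
    simpa [Measure.real, Function.comp_def] using
      (ENNReal.tendsto_toReal ENNReal.zero_ne_top).comp this
  have hlim2 : Tendsto (fun n => ε * m.real (U n) + C * m.real (U n)ᶜ) atTop
      (𝓝 (ε * m.real Set.univ)) := by
    have : ∀ n, m.real (U n) = m.real Set.univ - m.real (U n)ᶜ := fun n => by
      rw [← measureReal_add_measureReal_compl (μ := m) (hUm n)]; ring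
    simp_rw [this]
    simpa using ((hlim.const_sub (m.real Set.univ)).const_mul ε).add (hlim.const_mul C)
  refine ge_of_tendsto' hlim2 fun n => ?_
  have h := hadd (U n) (U n)ᶜ (hUm n) (hUm n).compl disjoint_compl_right
  have h' : ν Set.univ MeasurableSet.univ = ν (U n ∪ (U n)ᶜ) ((hUm n).union (hUm n).compl) := by
    congr 1
    exact (Set.union_compl_self _).symm
  rw [h', h]
  exact (abs_add_le _ _).trans (add_le_add (hUε n _ _ subset_rfl) (hC _ _))

end Cover

/-! ### Currents are alternating. -/

section Alternating

variable {X : Type*} [MetricSpace X] [MeasurableSpace X]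

theorem BorelC.restrict_union {A B : Set X} (hA : MeasurableSet A) (hB : MeasurableSet B)
    (hd : Disjoint A B) (β : BorelC X) :
    BorelC.restrict (A ∪ B) (hA.union hB) β = BorelC.restrict A hA β + BorelC.restrict B hB β :=
  Subtype.ext (Set.indicator_union_of_disjoint hd _)

theorem BorelC.restrict_univ (β : BorelC X) :
    BorelC.restrict Set.univ MeasurableSet.univ β = β :=
  Subtype.ext (Set.indicator_univ _)

theorem BorelC.restrict_ne_zero {B : Set X} {hB : MeasurableSet B} {β : BorelC X} {x : X}
    (hx : (BorelC.restrict B hB β : X → ℝ) x ≠ 0) : x ∈ B ∧ (β : X → ℝ) x ≠ 0 := by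
  rw [BorelC.restrict_apply] at hx
  exact ⟨Set.mem_of_indicator_ne_zero hx, fun h => hx (by simp [Set.indicator, h])⟩

variable [BorelSpace X]

theorem BorelC.integral_abs_restrict_le {M : Measure X} [IsFiniteMeasureOnCompacts M]
    {K B : Set X} (hK : IsCompact K) (hB : MeasurableSet B) {β : BorelC X} {c : ℝ}
    (hβK : ∀ x, (β : X → ℝ) x ≠ 0 → x ∈ K) (hc : ∀ x ∈ B, |(β : X → ℝ) x| ≤ c) :
    ∫ x, |(BorelC.restrict B hB β : X → ℝ) x| ∂M ≤ c * (M.restrict K).real B := by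
  have hBK : MeasurableSet (B ∩ K) := hB.inter hK.measurableSet
  have hfin : M (B ∩ K) ≠ ⊤ :=
    ((measure_mono Set.inter_subset_right).trans_lt hK.measure_lt_top).ne
  rw [measureReal_restrict_apply hB, mul_comm, ← smul_eq_mul, ← integral_indicator_const c hBK]
  refine integral_mono (BorelC.integrable _ _).abs
    ((integrable_indicator_iff hBK).2 (integrableOn_const hfin)) fun x => ?_
  change |B.indicator (β : X → ℝ) x| ≤ _
  by_cases hx : x ∈ B
  · by_cases hxK : x ∈ K
    · simpa [hx, hxK] using hc x hx
    · simp [hx, hxK, not_not.1 fun h => hxK (hβK x h)]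
  · simp [hx]

variable [LocallyCompactSpace X] [TopologicalSpace.SeparableSpace X] {k : ℕ}
  {T : MetricCurrent k X}

/-- The set function `B ↦ T(1_B β dg¹ ∧ … ∧ dgᵏ)` is dominated by the mass. -/
theorem MetricCurrent.exists_abs_borelExtension_restrict_le (hT : T.HasLocallyFiniteMass)
    {K : Set X} (hK : IsCompact K) {β : BorelC X} (hβK : tsupport (β : X → ℝ) ⊆ K)
    (g : Fin k → LipLoc X) : ∃ C : ℝ, ∀ B hB, |T.borelExtension hT (BorelC.restrict B hB β) g| ≤
      C * ((massMeasure T.toFun).restrict K).real B := by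
  have := hT.isFiniteMeasureOnCompacts
  choose L hL using fun i => LipLoc.exists_lipschitzOnWith (g i) hK
  obtain ⟨A, hA⟩ := β.2.2.1
  refine ⟨(∏ i, (L i : ℝ)) * A, fun B hB => ?_⟩
  refine (T.abs_borelExtension_le hT (fun x hx => hβK (subset_tsupport _
    (BorelC.restrict_ne_zero hx).2)) hL).trans ?_
  rw [mul_assoc]
  exact mul_le_mul_of_nonneg_left (BorelC.integral_abs_restrict_le hK hB
    (fun x hx => hβK (subset_tsupport _ hx)) fun x _ => hA x)
    (Finset.prod_nonneg fun i _ => (L i).coe_nonneg)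

/-- A function constant where `β ≠ 0` has Lipschitz constant `0` there, so the product in the mass
bound vanishes. -/
theorem MetricCurrent.borelExtension_eq_zero_of_eq_const (hT : T.HasLocallyFiniteMass)
    (β : BorelC X) (g : Fin k → LipLoc X) (i : Fin k) (c : ℝ)
    (hc : ∀ x, (β : X → ℝ) x ≠ 0 → (g i : X → ℝ) x = c) : T.borelExtension hT β g = 0 := by
  choose L hL using fun i => LipLoc.exists_lipschitzOnWith (g i) β.2.2.2
  have h := T.abs_borelExtension_le hT (β := β) (B := Function.support (β : X → ℝ)) (g := g)
    (L := Function.update L i 0) (fun x hx => hx) fun j => ?_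
  · have h0 : ∏ j, ((Function.update L i 0 j : ℝ≥0) : ℝ) = 0 :=
      Finset.prod_eq_zero (Finset.mem_univ i) (by simp)
    rw [h0, zero_mul] at h
    exact abs_nonpos_iff.1 h
  · by_cases hj : j = i
    · subst hj
      rw [Function.update_self]
      exact LipschitzOnWith.of_dist_le_mul fun x hx y hy => by simp [hc x hx, hc y hy]
    · rw [Function.update_of_ne hj]
      exact (hL j).mono (subset_tsupport _)

/-- The distance from `t` to the lattice `a⁻¹ ℤ`. -/
noncomputable def latticeDist (a t : ℝ) : ℝ := |a * t - round (a * t)| / a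

theorem lipschitzWith_latticeDist {a : ℝ} (ha : 0 < a) : LipschitzWith 1 (latticeDist a) := by
  refine LipschitzWith.of_le_add fun x y => ?_
  unfold latticeDist
  rw [div_add' _ _ _ ha.ne']
  refine div_le_div_of_nonneg_right ?_ ha.le
  -- The integer nearest to `a * y` competes with the one nearest to `a * x`.
  have h1 := round_le (a * x) (round (a * y))
  have h2 : |a * x - round (a * y)| ≤ |a * y - round (a * y)| + |a * x - a * y| := by
    have := abs_add_le (a * y - round (a * y)) (a * x - a * y)
    rwa [sub_add_sub_cancel'] at this
  have h3 : |a * x - a * y| = dist x y * a := by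
    rw [← mul_sub, abs_mul, abs_of_pos ha, mul_comm, Real.dist_eq]
  linarith

theorem abs_latticeDist_le {a : ℝ} (ha : 0 < a) (t : ℝ) : |latticeDist a t| ≤ 1 / a := by
  unfold latticeDist
  rw [abs_div, abs_abs, abs_of_pos ha]
  have := abs_sub_round (a * t)
  exact div_le_div_of_nonneg_right (by linarith) ha.le

/-- Folding `h` in two complementary ways gives two functions one of which is constant on each
piece of a countable partition. -/
theorem MetricCurrent.borelExtension_fold_eq_zero (hT : T.HasLocallyFiniteMass) (β : BorelC X)
    (g : Fin k → LipLoc X) {i j : Fin k} (h : LipLoc X) {a : ℝ} (ha : 0 < a)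
    (hi : ∀ x, (g i : X → ℝ) x = (h : X → ℝ) x + latticeDist a ((h : X → ℝ) x))
    (hj : ∀ x, (g j : X → ℝ) x = (h : X → ℝ) x - latticeDist a ((h : X → ℝ) x)) :
    T.borelExtension hT β g = 0 := by
  have := hT.isFiniteMeasureOnCompacts
  have hK : IsCompact (tsupport (β : X → ℝ)) := β.2.2.2
  obtain ⟨C, hC⟩ := T.exists_abs_borelExtension_restrict_le hT hK subset_rfl g
  have hfin : IsFiniteMeasure ((massMeasure T.toFun).restrict (tsupport (β : X → ℝ))) :=
    ⟨by rw [Measure.restrict_apply_univ]; exact hK.measure_lt_top⟩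
  have hmeas : Measurable fun x => a * (h : X → ℝ) x :=
    ((LipLoc.continuous h).measurable).const_mul a
  have hround : Measurable fun x => round (a * (h : X → ℝ) x) := by
    simp_rw [round_eq]
    exact Int.measurable_floor.comp (hmeas.add_const _)
  have hup : ∀ z : ℤ, MeasurableSet {x | (z : ℝ) ≤ a * (h : X → ℝ) x} := fun z =>
    measurableSet_le measurable_const hmeas
  -- The pieces record the nearest lattice point `z / a` and the side of it on which `h` lies. Above
  -- it `latticeDist` is `h - z / a`, so `g j` is constantly `z / a`; below it, `g i` is.
  let P : ℤ × Bool → Set X := fun z => {x | round (a * (h : X → ℝ) x) = z.1} ∩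
    (if z.2 then {x | (z.1 : ℝ) ≤ a * (h : X → ℝ) x} else {x | (z.1 : ℝ) ≤ a * (h : X → ℝ) x}ᶜ)
  have hP : ∀ z, MeasurableSet (P z) := fun z => by
    refine (hround (measurableSet_singleton z.1)).inter ?_
    split_ifs
    exacts [hup _, (hup _).compl]
  have hcov : ⋃ z, P z = Set.univ := by
    refine Set.eq_univ_of_forall fun x => ?_
    by_cases hx : (round (a * (h : X → ℝ) x) : ℝ) ≤ a * (h : X → ℝ) x
    · exact Set.mem_iUnion.2 ⟨(round (a * (h : X → ℝ) x), true), rfl, by simpa using hx⟩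
    · exact Set.mem_iUnion.2 ⟨(round (a * (h : X → ℝ) x), false), rfl, by simpa using hx⟩
  -- With `ε = 0` the cover lemma upgrades vanishing on each piece to vanishing on the union.
  have key := abs_le_mul_measureReal_of_cover (ε := 0)
    (ν := fun B hB => T.borelExtension hT (BorelC.restrict B hB β) g)
    (fun A B hA hB hd => by rw [BorelC.restrict_union hA hB hd, map_add, add_apply])
    hC hP (by simp [hcov]) ?_
  · rw [zero_mul, BorelC.restrict_univ] at key
    exact abs_nonpos_iff.1 key
  · rintro ⟨z, b⟩ B hB hBP
    rw [zero_mul, abs_nonpos_iff]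
    cases b with
    | true =>
      refine T.borelExtension_eq_zero_of_eq_const hT _ g j (z / a) fun x hx => ?_
      obtain ⟨h1, h2⟩ := hBP (BorelC.restrict_ne_zero hx).1
      simp only [Set.mem_ofPred_eq, if_true] at h1 h2
      rw [hj, latticeDist, h1, abs_of_nonneg (sub_nonneg.2 h2)]
      field_simp
      ring
    | false =>
      refine T.borelExtension_eq_zero_of_eq_const hT _ g i (z / a) fun x hx => ?_
      obtain ⟨h1, h2⟩ := hBP (BorelC.restrict_ne_zero hx).1
      simp only [Bool.false_eq_true, if_false, Set.mem_compl_iff, Set.mem_ofPred_eq, not_le]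
        at h1 h2
      rw [hi, latticeDist, h1, abs_of_neg (sub_neg.2 h2)]
      field_simp
      ring

/-- A current is alternating in the functions `gⁱ`. -/
theorem MetricCurrent.borelExtension_eq_zero_of_eq (hT : T.HasLocallyFiniteMass) (β : BorelC X)
    (g : Fin k → LipLoc X) {i j : Fin k} (hij : i ≠ j) (h : g i = g j) :
    T.borelExtension hT β g = 0 := by
  have hpos : ∀ n : ℕ, (0 : ℝ) < (n : ℝ) + 1 := fun n => by positivity
  let φ : ℕ → ℝ → ℝ := fun n t => t + latticeDist (n + 1) t
  let ψ : ℕ → ℝ → ℝ := fun n t => t - latticeDist (n + 1) t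
  have hφ : ∀ n, LipschitzWith (1 + 1) (φ n) := fun n =>
    LipschitzWith.id.add (lipschitzWith_latticeDist (hpos n))
  have hψ : ∀ n, LipschitzWith (1 + 1) (ψ n) := fun n =>
    LipschitzWith.id.sub (lipschitzWith_latticeDist (hpos n))
  have h0 : ∀ t, Tendsto (fun n : ℕ => latticeDist ((n : ℝ) + 1) t) atTop (𝓝 0) := fun t =>
    squeeze_zero_norm (fun n => abs_latticeDist_le (hpos n) t)
      tendsto_one_div_add_atTop_nhds_zero_nat
  have hU := lipLocConverges_comp (h := g i) hφ (by simp) fun t => by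
    simpa using (h0 t).const_add t
  have hV := lipLocConverges_comp (h := g i) hψ (by simp) fun t => by
    simpa using (h0 t).const_sub t
  -- The two equal entries are folded at lattice spacing `1 / (n + 1)`. Both folds are `2`-Lipschitz
  -- functions of `g i` and converge to it, so `G n` converges to `g` while every value at `G n` is
  -- `0`.
  let G : ℕ → Fin k → LipLoc X := fun n => Function.update
    (Function.update g i ⟨_, comp_mem_LipLoc (hφ n) (g i)⟩) j ⟨_, comp_mem_LipLoc (hψ n) (g i)⟩
  have hG : ∀ l, LipLocConverges (fun n => G n l) (g l) := by
    intro l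
    by_cases hl : l = j
    · subst hl
      simpa [G, ← h] using hV
    · by_cases hl' : l = i
      · subst hl'
        simpa [G, hl] using hU
      · simpa [G, hl, hl'] using lipLocConverges_const (g l)
  refine tendsto_nhds_unique ((T.tendsto_borelExtension hT β hG).congr fun n => ?_)
    tendsto_const_nhds
  refine T.borelExtension_fold_eq_zero hT β (G n) (i := i) (j := j) (g i) (hpos n)
    (fun x => ?_) fun x => ?_
  · simp [G, hij, φ]
  · simp [G, ψ]

end Alternating

/-- In a basis the map is a polynomial in the coordinates. -/
theorem MultilinearMap.continuous_of_finiteDimensional_real {ι V : Type*} [Fintype ι]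
    [NormedAddCommGroup V] [NormedSpace ℝ V] [FiniteDimensional ℝ V]
    (f : MultilinearMap ℝ (fun _ : ι => V) ℝ) : Continuous f := by
  classical
  let e := Module.finBasis ℝ V
  have h : ∀ m : ι → V, f m = ∑ r : ι → Fin (Module.finrank ℝ V),
      (∏ i, e.coord (r i) (m i)) * f fun i => e (r i) := by
    intro m
    have hm : m = fun i => ∑ j, e.coord j (m i) • e j := funext fun i => (e.sum_repr (m i)).symm
    conv_lhs => rw [hm]
    rw [MultilinearMap.map_sum]
    exact Finset.sum_congr rfl fun r _ => f.map_smul_univ _ _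
  rw [show ⇑f = _ from funext h]
  refine continuous_finsetSum _ fun r _ =>
    (continuous_finsetProd _ fun i _ => ?_).mul continuous_const
  exact (LinearMap.continuous_of_finiteDimensional (e.coord (r i))).comp (continuous_apply i)

/-! ### Perturbing the functions $g^i$. -/

section Telescoping

variable {X : Type*} [MetricSpace X] [MeasurableSpace X] [BorelSpace X] [LocallyCompactSpace X]
  [TopologicalSpace.SeparableSpace X] {k : ℕ} {T : MetricCurrent k X}

/-- Replacing all `gⁱ` by functions differing from them by `ε`-Lipschitz functions. -/
theorem MetricCurrent.abs_borelExtension_sub_le (hT : T.HasLocallyFiniteMass) {β : BorelC X}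
    {B : Set X} (hB : ∀ x, (β : X → ℝ) x ≠ 0 → x ∈ B) {g g' : Fin k → LipLoc X} {A ε : ℝ≥0}
    (hA : 1 ≤ A) (hg : ∀ i, LipschitzOnWith A (g i : X → ℝ) B)
    (hg' : ∀ i, LipschitzOnWith A (g' i : X → ℝ) B)
    (hε : ∀ i, LipschitzOnWith ε ((g' i - g i : LipLoc X) : X → ℝ) B) :
    |T.borelExtension hT β g' - T.borelExtension hT β g| ≤
      k * (A : ℝ) ^ k * ε * ∫ x, |(β : X → ℝ) x| ∂massMeasure T.toFun := by
  set I := ∫ x, |(β : X → ℝ) x| ∂massMeasure T.toFun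
  have hI : 0 ≤ I := integral_nonneg fun _ => abs_nonneg _
  suffices H : ∀ s : Finset (Fin k),
      |T.borelExtension hT β (s.piecewise g' g) - T.borelExtension hT β g| ≤
        s.card * ((A : ℝ) ^ k * ε * I) by
    have := H Finset.univ
    rw [Finset.piecewise_univ, Finset.card_univ, Fintype.card_fin] at this
    refine this.trans (le_of_eq ?_)
    ring
  intro s
  induction s using Finset.induction_on with
  | empty => simp
  | insert j s hj ih =>
    have hself : T.borelExtension hT β (s.piecewise g' g) = T.borelExtension hT β
        (Function.update (s.piecewise g' g) j (g j)) := by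
      rw [← Finset.piecewise_eq_of_notMem s g' g hj, Function.update_eq_self]
    have hstep : |T.borelExtension hT β ((insert j s).piecewise g' g) -
        T.borelExtension hT β (s.piecewise g' g)| ≤ (A : ℝ) ^ k * ε * I := by
      rw [Finset.piecewise_insert, hself, ← MultilinearMap.map_update_sub]
      refine (T.abs_borelExtension_le hT hB (L := Function.update (fun _ => A) j ε)
        fun i => ?_).trans ?_
      · by_cases hi : i = j
        · subst hi
          simpa using hε i
        · rw [Function.update_of_ne hi, Function.update_of_ne hi]
          by_cases his : i ∈ s
          · rw [Finset.piecewise_eq_of_mem _ _ _ his]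
            exact hg' i
          · rw [Finset.piecewise_eq_of_notMem _ _ _ his]
            exact hg i
      · refine mul_le_mul_of_nonneg_right ?_ hI
        -- The product is `A ^ (k - 1) * ε`; the hypothesis `1 ≤ A` permits the exponent `k`.
        have : ∏ i, Function.update (fun _ : Fin k => A) j ε i ≤ A ^ k * ε := by
          rw [Finset.prod_update_of_mem (Finset.mem_univ j), Finset.prod_const, mul_comm]
          refine mul_le_mul_left (pow_le_pow_right₀ hA ?_) _
          exact (Finset.card_le_univ _).trans (by simp)
        exact_mod_cast this
    rw [Finset.card_insert_of_notMem hj]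
    push_cast
    have := abs_sub_le (T.borelExtension hT β ((insert j s).piecewise g' g))
      (T.borelExtension hT β (s.piecewise g' g)) (T.borelExtension hT β g)
    linarith

end Telescoping

/-! ### Currents on linear functions of the chart. -/

section Chart

variable {X : Type*} [MetricSpace X] {E : Type*} [NormedAddCommGroup E] [InnerProductSpace ℝ E]

/-- The pullback of linear functionals under a Lipschitz map. -/
def dualPullback {π : X → E} {L : ℝ≥0} (hπ : LipschitzWith L π) :
    StrongDual ℝ E →ₗ[ℝ] LipLoc X where
  toFun D := ⟨fun x => D (π x), (D.lipschitz.comp hπ).locallyLipschitz⟩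
  map_add' _ _ := rfl
  map_smul' _ _ := rfl

variable [MeasurableSpace X] [BorelSpace X] [LocallyCompactSpace X]
  [TopologicalSpace.SeparableSpace X] {k : ℕ} {T : MetricCurrent k X}

/-- `(D¹, …, Dᵏ) ↦ T(β d(D¹ ∘ π) ∧ … ∧ d(Dᵏ ∘ π))`. -/
noncomputable def MetricCurrent.chartForm (hT : T.HasLocallyFiniteMass) {π : X → E} {L : ℝ≥0}
    (hπ : LipschitzWith L π) (β : BorelC X) : StrongDual ℝ E [⋀^Fin k]→ₗ[ℝ] ℝ :=
  { (T.borelExtension hT β).compLinearMap fun _ => dualPullback hπ with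
    map_eq_zero_of_eq' := fun D _ _ h hij =>
      T.borelExtension_eq_zero_of_eq hT β (fun l => dualPullback hπ (D l)) hij
        (congrArg (dualPullback hπ) h) }

theorem MetricCurrent.chartForm_apply (hT : T.HasLocallyFiniteMass) {π : X → E} {L : ℝ≥0}
    (hπ : LipschitzWith L π) (β : BorelC X) (D : Fin k → StrongDual ℝ E) :
    T.chartForm hT hπ β D = T.borelExtension hT β fun i => dualPullback hπ (D i) := rfl

/-- The current `T` in the chart `π`, as a bilinear map on coefficients and constant `k`-covectors.
-/
noncomputable def MetricCurrent.chartCovector (hT : T.HasLocallyFiniteMass) {π : X → E} {L : ℝ≥0}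
    (hπ : LipschitzWith L π) : BorelC X →ₗ[ℝ] (⋀[ℝ]^k (StrongDual ℝ E)) →ₗ[ℝ] ℝ :=
  exteriorPower.alternatingMapLinearEquiv.toLinearMap ∘ₗ
    { toFun := T.chartForm hT hπ
      map_add' := fun β γ => AlternatingMap.ext fun D => by
        simp only [AlternatingMap.add_apply, T.chartForm_apply, map_add, add_apply]
      map_smul' := fun c β => AlternatingMap.ext fun D => by
        simp only [AlternatingMap.smul_apply, T.chartForm_apply, map_smul, smul_apply,
          RingHom.id_apply] }

theorem MetricCurrent.chartCovector_ιMulti (hT : T.HasLocallyFiniteMass) {π : X → E} {L : ℝ≥0}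
    (hπ : LipschitzWith L π) (β : BorelC X) (D : Fin k → StrongDual ℝ E) :
    T.chartCovector hT hπ β (exteriorPower.ιMulti ℝ k D) =
      T.borelExtension hT β fun i => dualPullback hπ (D i) :=
  exteriorPower.alternatingMapLinearEquiv_apply_ιMulti _ _

/-- On a decomposable covector this is the mass bound with constants `‖D i‖ * L`, valid on all of
`X`; decomposable covectors span. -/
theorem MetricCurrent.exists_abs_chartCovector_le (hT : T.HasLocallyFiniteMass) {π : X → E}
    {L : ℝ≥0} (hπ : LipschitzWith L π) (v : ⋀[ℝ]^k (StrongDual ℝ E)) :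
    ∃ C : ℝ, 0 ≤ C ∧ ∀ β : BorelC X, |T.chartCovector hT hπ β v| ≤
      C * ∫ x, |(β : X → ℝ) x| ∂massMeasure T.toFun := by
  have hv : v ∈ Submodule.span ℝ (Set.range (exteriorPower.ιMulti ℝ k (M := StrongDual ℝ E))) := by
    rw [exteriorPower.ιMulti_span]
    exact Submodule.mem_top
  induction hv using Submodule.span_induction with
  | mem v hv =>
    obtain ⟨D, rfl⟩ := hv
    refine ⟨∏ i, ((‖D i‖₊ * L : ℝ≥0) : ℝ), Finset.prod_nonneg fun i _ => NNReal.coe_nonneg _,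
      fun β => ?_⟩
    rw [T.chartCovector_ιMulti]
    exact T.abs_borelExtension_le hT (B := Set.univ) (fun _ _ => Set.mem_univ _)
      fun i => ((D i).lipschitz.comp hπ).lipschitzOnWith
  | zero => exact ⟨0, le_rfl, fun β => by simp⟩
  | add v w _ _ hv hw =>
    obtain ⟨C, hC, h⟩ := hv
    obtain ⟨C', hC', h'⟩ := hw
    refine ⟨C + C', by positivity, fun β => ?_⟩
    rw [map_add, add_mul]
    exact (abs_add_le _ _).trans (add_le_add (h β) (h' β))
  | smul c v _ hv =>
    obtain ⟨C, hC, h⟩ := hv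
    refine ⟨|c| * C, by positivity, fun β => ?_⟩
    rw [map_smul, smul_eq_mul, abs_mul, mul_assoc]
    exact mul_le_mul_of_nonneg_left (h β) (abs_nonneg _)

/-- On a set where the `g_sⁱ` are close to `D_sⁱ ∘ π` and `∑ β_s D_s¹ ∧ … ∧ D_sᵏ` is small, the
current has small values on `∑ β_s dg_s¹ ∧ … ∧ dg_sᵏ`. -/
theorem MetricCurrent.exists_abs_sum_restrict_le (hT : T.HasLocallyFiniteMass) {π : X → E} {L : ℝ≥0}
    (hπ : LipschitzWith L π) {S : Type*} [Fintype S] (β : S → BorelC X) (g : S → Fin k → LipLoc X)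
    {K : Set X} (hK : IsCompact K) (hβK : ∀ s, tsupport (β s : X → ℝ) ⊆ K) {ι : Type*} [Fintype ι]
    (b : Module.Basis ι ℝ (⋀[ℝ]^k (StrongDual ℝ E))) :
    ∃ C : ℝ, ∀ ε : ℝ≥0, ε ≤ 1 → ∀ (P : Set X) (D : S → Fin k → StrongDual ℝ E),
      (∀ s i, LipschitzOnWith ε (fun x => (g s i : X → ℝ) x - D s i (π x)) P) →
      (∀ x ∈ P, ∀ I, |b.coord I (∑ s, (β s : X → ℝ) x • exteriorPower.ιMulti ℝ k (D s))| ≤ ε) →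
      ∀ B (hB : MeasurableSet B), B ⊆ P →
        |∑ s, T.borelExtension hT (BorelC.restrict B hB (β s)) (g s)| ≤
          C * ε * ((massMeasure T.toFun).restrict K).real B := by
  have := hT.isFiniteMeasureOnCompacts
  choose Λ hΛ using fun s i => LipLoc.exists_lipschitzOnWith (g s i) hK
  choose N hN using fun s => (β s).2.2.1
  choose Q hQ0 hQ using fun I => T.exists_abs_chartCovector_le hT hπ (b I)
  -- The summand `1` leaves room for `ε ≤ 1`: where `g - D ∘ π` is `ε`-Lipschitz, `D ∘ π` is `(Λ +
  -- ε)`-Lipschitz. So `A` serves for both families, whatever the size of `D`.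
  let A : ℝ≥0 := (∑ s, ∑ i, Λ s i) + 1
  have hA1 : 1 ≤ A := le_add_of_nonneg_left zero_le
  have hΛA : ∀ s i, Λ s i + 1 ≤ A := fun s i => by
    refine add_le_add ?_ le_rfl
    exact (Finset.single_le_sum (f := fun i => Λ s i) (fun _ _ => zero_le) (Finset.mem_univ i)).trans
      (Finset.single_le_sum (f := fun s => ∑ i, Λ s i) (fun _ _ => zero_le) (Finset.mem_univ s))
  refine ⟨∑ s, k * (A : ℝ) ^ k * N s + ∑ I, Q I, fun ε hε P D hgD hform B hB hBP => ?_⟩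
  set m := ((massMeasure T.toFun).restrict K).real B
  let h : S → Fin k → LipLoc X := fun s i => dualPullback hπ (D s i)
  have hfirst : ∀ s, |T.borelExtension hT (BorelC.restrict B hB (β s)) (g s) -
      T.borelExtension hT (BorelC.restrict B hB (β s)) (h s)| ≤
        k * (A : ℝ) ^ k * ε * (N s * m) := by
    intro s
    have hdiff : ∀ i, LipschitzOnWith ε ((g s i - h s i : LipLoc X) : X → ℝ) (P ∩ K) := fun i =>
      (hgD s i).mono Set.inter_subset_left
    have hgK : ∀ i, LipschitzOnWith (Λ s i) (g s i : X → ℝ) (P ∩ K) := fun i =>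
      (hΛ s i).mono Set.inter_subset_right
    refine (T.abs_borelExtension_sub_le hT (B := P ∩ K) (fun x hx => ?_)
      hA1 (fun i => ?_) (fun i => ?_) hdiff).trans ?_
    · exact ⟨hBP (BorelC.restrict_ne_zero hx).1,
        hβK s (subset_tsupport _ (BorelC.restrict_ne_zero hx).2)⟩
    · have := (hgK i).sub (hdiff i)
      refine LipschitzOnWith.weaken (K := Λ s i + ε) ?_
        ((add_le_add le_rfl hε).trans (hΛA s i))
      have e : (h s i : X → ℝ) = (g s i : X → ℝ) - ((g s i - h s i : LipLoc X) : X → ℝ) := by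
        rw [Submodule.coe_sub, sub_sub_cancel]
      rw [e]
      exact this
    · exact (hgK i).weaken (le_self_add.trans (hΛA s i))
    · refine mul_le_mul_of_nonneg_left ?_ (by positivity)
      exact BorelC.integral_abs_restrict_le hK hB (fun x hx => hβK s (subset_tsupport _ hx))
        fun x _ => hN s x
  have hsecond : |∑ s, T.borelExtension hT (BorelC.restrict B hB (β s)) (h s)| ≤
      ∑ I, Q I * (ε * m) := by
    -- Regrouping by basis covectors: `γ I` is the `I`-th coordinate of
    -- $\sum_s\beta_sD_s^1\wedge\dots\wedge D_s^k$. The cancellation between different `s` happens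
    -- here, and `γ I` is at most `ε` on `P`.
    let γ : ι → BorelC X := fun I => ∑ s, b.coord I (exteriorPower.ιMulti ℝ k (D s)) • β s
    have hγ : ∀ I x, (γ I : X → ℝ) x =
        b.coord I (∑ s, (β s : X → ℝ) x • exteriorPower.ιMulti ℝ k (D s)) := by
      intro I x
      rw [map_sum, Submodule.coe_sum, Finset.sum_apply]
      refine Finset.sum_congr rfl fun s _ => ?_
      rw [map_smul, smul_eq_mul, mul_comm]
      rfl
    have heq : ∑ s, T.borelExtension hT (BorelC.restrict B hB (β s)) (h s) =
        ∑ I, T.chartCovector hT hπ (BorelC.restrict B hB (γ I)) (b I) := by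
      have h1 : ∀ s, T.borelExtension hT (BorelC.restrict B hB (β s)) (h s) =
          ∑ I, b.coord I (exteriorPower.ιMulti ℝ k (D s)) *
            T.chartCovector hT hπ (BorelC.restrict B hB (β s)) (b I) := by
        intro s
        rw [← T.chartCovector_ιMulti hT hπ]
        conv_lhs => rw [← b.sum_repr (exteriorPower.ιMulti ℝ k (D s))]
        rw [map_sum]
        exact Finset.sum_congr rfl fun I _ => by rw [map_smul]; rfl
      simp_rw [h1]
      rw [Finset.sum_comm]
      refine Finset.sum_congr rfl fun I _ => ?_
      simp only [γ, map_sum, map_smul, LinearMap.sum_apply, LinearMap.smul_apply, smul_eq_mul]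
    rw [heq]
    refine (Finset.abs_sum_le_sum_abs _ _).trans (Finset.sum_le_sum fun I _ => ?_)
    refine (hQ I _).trans (mul_le_mul_of_nonneg_left ?_ (hQ0 I))
    refine BorelC.integral_abs_restrict_le hK hB (fun x hx => ?_) fun x hx => ?_
    · by_contra hxK
      apply hx
      rw [hγ, Finset.sum_eq_zero, map_zero]
      intro s _
      rw [image_eq_zero_of_notMem_tsupport fun h => hxK (hβK s h), zero_smul]
    · rw [hγ]
      exact hform x (hBP hx) I
  have hsplit : ∑ s, T.borelExtension hT (BorelC.restrict B hB (β s)) (g s) =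
      ∑ s, (T.borelExtension hT (BorelC.restrict B hB (β s)) (g s) -
        T.borelExtension hT (BorelC.restrict B hB (β s)) (h s)) +
      ∑ s, T.borelExtension hT (BorelC.restrict B hB (β s)) (h s) := by
    rw [Finset.sum_sub_distrib, sub_add_cancel]
  rw [hsplit]
  refine (abs_add_le _ _).trans ((add_le_add ((Finset.abs_sum_le_sum_abs _ _).trans
    (Finset.sum_le_sum fun s _ => hfirst s)) hsecond).trans (le_of_eq ?_))
  rw [add_mul, add_mul, Finset.sum_mul, Finset.sum_mul, Finset.sum_mul, Finset.sum_mul]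
  congr 1
  · exact Finset.sum_congr rfl fun s _ => by ring
  · exact Finset.sum_congr rfl fun I _ => by ring

end Chart

/-! ### Pieces on which the functions are almost linear in the chart. -/

section Pieces

variable {X : Type*} [MetricSpace X] {E : Type*} [NormedAddCommGroup E] [InnerProductSpace ℝ E]
  {k : ℕ} {S : Type*}

/-- The points of `Y` in the ball of radius `r / 2` about `c` at which the `g_sⁱ` are approximated
by `D_sⁱ ∘ π` with relative error `ε` at scale `r`. -/
def affineApproxSet (Y : Set X) (π : X → E) (g : S → Fin k → LipLoc X) (ε r : ℝ) (c : X)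
    (D : S → Fin k → StrongDual ℝ E) : Set X :=
  {y | y ∈ Y ∧ dist y c < r / 2 ∧ ∀ z ∈ Y, dist z y < r → ∀ s i,
    |(g s i : X → ℝ) z - (g s i : X → ℝ) y - D s i (π z - π y)| ≤ ε * dist z y}

/-- Two points of the set are less than `r` apart, so the approximation at one applies to the other.
The bound passes to the closure by continuity, which supplies a Borel set although `Y` need not be
Borel. -/
theorem lipschitzOnWith_closure_affineApproxSet {Y : Set X} {π : X → E} (hπ : Continuous π)
    {g : S → Fin k → LipLoc X} {ε : ℝ≥0} {r : ℝ} {c : X} {D : S → Fin k → StrongDual ℝ E} (s : S)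
    (i : Fin k) : LipschitzOnWith ε (fun x => (g s i : X → ℝ) x - D s i (π x))
      (closure (affineApproxSet Y π g ε r c D)) := by
  refine LipschitzOnWith.closure (((LipLoc.continuous (g s i)).sub
    ((D s i).continuous.comp hπ)).continuousOn) (LipschitzOnWith.of_dist_le_mul ?_)
  rintro z ⟨hzY, hzc, -⟩ y ⟨-, hyc, hy⟩
  have hzy : dist z y < r := by
    have := dist_triangle_right z y c
    linarith
  have := hy z hzY hzy s i
  rw [map_sub] at this
  rw [Real.dist_eq]
  refine le_trans (le_of_eq ?_) this
  congr 1
  ring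

/-- At a point of differentiability, linear functionals near the differentials give good
approximations at small scales. -/
theorem eventually_affine_approx [Fintype S] {Y : Set X} {π₀ : Y → E} {π : X → E} {L : ℝ≥0}
    (hπ : LipschitzWith L π) (hππ : ∀ y : Y, π y = π₀ y) (g : S → Fin k → LipLoc X) (y : Y)
    (D₀ : S → Fin k → StrongDual ℝ E)
    (hD₀ : ∀ s i, IsDifferentialAt π₀ (g s i : X → ℝ) y (D₀ s i)) {ε : ℝ} (hε : 0 < ε) :
    ∃ r : ℝ, 0 < r ∧ ∀ᶠ D in 𝓝 D₀, ∀ z ∈ Y, dist z y < r → ∀ s i,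
      |(g s i : X → ℝ) z - (g s i : X → ℝ) y - D s i (π z - π y)| ≤ ε * dist z (y : X) := by
  have h1 : ∀ᶠ z : Y in 𝓝 y, ∀ s i,
      |(g s i : X → ℝ) z - (g s i : X → ℝ) y - D₀ s i (π z - π y)| ≤
        ε / 2 * dist (z : X) (y : X) := by
    refine eventually_all.2 fun s => eventually_all.2 fun i => ?_
    filter_upwards [(hD₀ s i).def (half_pos hε)] with z hz
    rw [hππ, hππ]
    rw [Real.norm_eq_abs, Real.norm_eq_abs] at hz
    refine hz.trans_eq ?_
    rw [Subtype.dist_eq, abs_of_nonneg dist_nonneg]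
  obtain ⟨r, hr, hball⟩ := Metric.eventually_nhds_iff.1 h1
  refine ⟨r, hr, ?_⟩
  -- Half of the error is kept for moving `D₀` to a nearby `D`, later taken from a countable dense
  -- set; the radius `r` depends on `D₀` only.
  have h2 : ∀ᶠ D in 𝓝 D₀, ∀ s i, ‖D s i - D₀ s i‖ * L < ε / 2 := by
    refine eventually_all.2 fun s => eventually_all.2 fun i => ?_
    have hc : Continuous fun D : S → Fin k → StrongDual ℝ E => ‖D s i - D₀ s i‖ * L := by
      fun_prop
    refine hc.continuousAt.eventually_lt_const ?_
    simpa using half_pos hε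
  filter_upwards [h2] with D hD z hz hzy s i
  have e1 := hball (y := ⟨z, hz⟩) hzy s i
  have e2 : |(D s i - D₀ s i) (π z - π y)| ≤ ε / 2 * dist z (y : X) := by
    refine ((D s i - D₀ s i).le_opNorm _).trans ?_
    have e3 : ‖π z - π y‖ ≤ L * dist z (y : X) := by
      rw [← dist_eq_norm]
      exact hπ.dist_le_mul z y
    calc ‖D s i - D₀ s i‖ * ‖π z - π y‖ ≤ ‖D s i - D₀ s i‖ * (L * dist z (y : X)) := by gcongr
      _ = (‖D s i - D₀ s i‖ * L) * dist z (y : X) := by ring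
      _ ≤ _ := by
        have := (hD s i).le
        gcongr
  have e4 : (g s i : X → ℝ) z - (g s i : X → ℝ) y - D s i (π z - π y) =
      ((g s i : X → ℝ) z - (g s i : X → ℝ) y - D₀ s i (π z - π y)) -
        (D s i - D₀ s i) (π z - π y) := by
    rw [sub_apply]
    ring
  rw [e4]
  refine (abs_sub _ _).trans ?_
  linarith

end Pieces

/-! ### Concentration on the vanishing set. -/

section VanishingSet

variable {X : Type*} [MetricSpace X] [MeasurableSpace X] {E : Type*} [NormedAddCommGroup E]
  [InnerProductSpace ℝ E] {k : ℕ} {S : Type*} [Fintype S]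

theorem measurableSet_coord_sum_le {ι : Type*} [Countable ι]
    (b : Module.Basis ι ℝ (⋀[ℝ]^k (StrongDual ℝ E))) (β : S → BorelC X)
    (D : S → Fin k → StrongDual ℝ E) (ε : ℝ) :
    MeasurableSet {x | ∀ I, |b.coord I
      (∑ s, (β s : X → ℝ) x • exteriorPower.ιMulti ℝ k (D s))| ≤ ε} := by
  simp_rw [map_sum, map_smul, smul_eq_mul]
  rw [Set.ofPred_forall]
  refine MeasurableSet.iInter fun I => measurableSet_le ?_ measurable_const
  refine Measurable.abs (Finset.measurable_fun_sum _ fun s _ => ?_)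
  exact (β s).2.1.mul_const _

variable [FiniteDimensional ℝ E]

theorem continuous_coord_sum_ιMulti {ι : Type*}
    (b : Module.Basis ι ℝ (⋀[ℝ]^k (StrongDual ℝ E))) (I : ι) (a : S → ℝ) :
    Continuous fun D : S → Fin k → StrongDual ℝ E =>
      b.coord I (∑ s, a s • exteriorPower.ιMulti ℝ k (D s)) := by
  simp_rw [map_sum, map_smul, smul_eq_mul]
  refine continuous_finsetSum _ fun s _ => continuous_const.mul ?_
  exact (MultilinearMap.continuous_of_finiteDimensional_real
    ((b.coord I).compMultilinearMap (exteriorPower.ιMulti ℝ k (M := StrongDual ℝ E)).toMultilinearMap)).comp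
    (continuous_apply s)

variable [BorelSpace X] [LocallyCompactSpace X] [TopologicalSpace.SeparableSpace X]
  {T : MetricCurrent k X}

theorem MetricCurrent.sum_borelExtension_eq_zero (hT : T.HasLocallyFiniteMass) {Y : Set X}
    {π₀ : Y → E} (hπ₀ : ∃ L : ℝ≥0, LipschitzWith L π₀) (β : S → BorelC X)
    (g : S → Fin k → LipLoc X)
    (hconc : T.IsConcentratedOn (cheegerVanishingSet π₀ (fun s => (β s : X → ℝ)) g)) :
    ∑ s, T.borelExtension hT (β s) (g s) = 0 := by
  have := hT.isFiniteMeasureOnCompacts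
  -- The chart is extended to `X` so that linear functionals of it can be entries of `T`, and so
  -- that closures of subsets of `Y` make sense as pieces.
  obtain ⟨π, L, hπ, hππ⟩ : ∃ (π : X → E) (L : ℝ≥0), LipschitzWith L π ∧ ∀ y : Y, π y = π₀ y := by
    obtain ⟨L₀, hL₀⟩ := hπ₀
    have hon : LipschitzOnWith L₀ (Function.extend Subtype.val π₀ 0) Y := by
      rw [lipschitzOnWith_iff_restrict]
      convert hL₀
      funext y
      exact Subtype.val_injective.extend_apply _ _ y
    obtain ⟨π, hπ, heq⟩ := hon.extend_finite_dimension
    exact ⟨π, _, hπ, fun y => (heq y.2).symm.trans (Subtype.val_injective.extend_apply _ _ y)⟩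
  let b := Module.finBasis ℝ (⋀[ℝ]^k (StrongDual ℝ E))
  let K : Set X := ⋃ s, tsupport (β s : X → ℝ)
  have hK : IsCompact K := isCompact_iUnion fun s => (β s).2.2.2
  have hβK : ∀ s, tsupport (β s : X → ℝ) ⊆ K := fun s =>
    Set.subset_iUnion (fun s => tsupport (β s : X → ℝ)) s
  obtain ⟨C, hC⟩ := T.exists_abs_sum_restrict_le hT hπ β g hK hβK b
  choose Q hQ using fun s => T.exists_abs_borelExtension_restrict_le hT hK (hβK s) (g s)
  set m := (massMeasure T.toFun).restrict K
  have hfin : IsFiniteMeasure m :=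
    ⟨by rw [Measure.restrict_apply_univ]; exact hK.measure_lt_top⟩
  have := FiniteDimensional.proper ℝ (StrongDual ℝ E)
  obtain ⟨Ds, hDs, hDd⟩ := TopologicalSpace.exists_countable_dense (S → Fin k → StrongDual ℝ E)
  obtain ⟨Xs, hXs, hXd⟩ := TopologicalSpace.exists_countable_dense X
  have := hDs.to_subtype
  have := hXs.to_subtype
  have main : ∀ ε : ℝ≥0, 0 < ε → ε ≤ 1 →
      |∑ s, T.borelExtension hT (β s) (g s)| ≤ C * ε * m.real Set.univ := by
    intro ε hε hε1
    have hε' : (0 : ℝ) < ε := hε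
    -- Scales `1 / (n + 1)`, centres and covectors all range over countable sets, so there are
    -- countably many pieces.
    let P : ℕ × Xs × Ds → Set X := fun j =>
      closure (affineApproxSet Y π g ε (1 / ((j.1 : ℝ) + 1)) j.2.1 j.2.2) ∩
        {x | ∀ I, |b.coord I (∑ s, (β s : X → ℝ) x • exteriorPower.ιMulti ℝ k (j.2.2.1 s))| ≤ ε}
    have hP : ∀ j, MeasurableSet (P j) := fun j =>
      isClosed_closure.measurableSet.inter (measurableSet_coord_sum_le b β _ _)
    have hsub : (⋃ j, P j)ᶜ ⊆ (cheegerVanishingSet π₀ (fun s => (β s : X → ℝ)) g)ᶜ := by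
      refine Set.compl_subset_compl.2 ?_
      rintro _ ⟨y, ⟨hdiff, hzero⟩, rfl⟩
      let D₀ : S → Fin k → StrongDual ℝ E := fun s i => cheegerDiff π₀ (g s i : X → ℝ) y
      have hD₀ : ∀ s i, IsDifferentialAt π₀ (g s i : X → ℝ) y (D₀ s i) := by
        intro s i
        simp only [D₀, cheegerDiff, dif_pos (hdiff s i)]
        exact (hdiff s i).choose_spec.1
      obtain ⟨r, hr, hev⟩ := eventually_affine_approx hπ hππ g y D₀ hD₀ hε'
      -- At the differentials themselves the covector is zero because the point lies in $Y_\omega$;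
      -- continuity in `D` keeps its coordinates below `ε` nearby.
      have hev2 : ∀ᶠ D in 𝓝 D₀, ∀ I, |b.coord I
          (∑ s, (β s : X → ℝ) y • exteriorPower.ιMulti ℝ k (D s))| < ε := by
        refine eventually_all.2 fun I => ?_
        refine (continuous_coord_sum_ιMulti b I
          fun s => (β s : X → ℝ) y).abs.continuousAt.eventually_lt_const ?_
        simp only [D₀, hzero, map_zero, abs_zero]
        exact hε'
      obtain ⟨D, hDmem, hD⟩ := hDd.exists_mem_open isOpen_interior
        ⟨D₀, mem_interior_iff_mem_nhds.2 (hev.and hev2)⟩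
      obtain ⟨hD1, hD2⟩ := interior_subset hD
      obtain ⟨n, hn⟩ := exists_nat_one_div_lt hr
      -- The centre must be within half of the scale `1 / (n + 1)`, which in turn is smaller than
      -- `r`.
      obtain ⟨c, hc, hyc⟩ := hXd.exists_dist_lt (y : X)
        (show 0 < 1 / ((n : ℝ) + 1) / 2 by positivity)
      refine Set.mem_iUnion.2 ⟨(n, ⟨c, hc⟩, ⟨D, hDmem⟩), subset_closure ⟨y.2, hyc, ?_⟩,
        fun I => (hD2 I).le⟩
      exact fun z hz hzy s i => hD1 z hz (hzy.trans hn) s i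
    have hcov : m (⋃ j, P j)ᶜ = 0 := by
      refine le_antisymm (((Measure.restrict_le_self _).trans (measure_mono hsub)).trans
        ((massMeasure_le_massOuter _ _).trans hconc.le)) zero_le
    have key := abs_le_mul_measureReal_of_cover (m := m) (ε := C * ε) (C := ∑ s, Q s)
      (ν := fun B hB => ∑ s, T.borelExtension hT (BorelC.restrict B hB (β s)) (g s))
      (fun A B hA hB hd => by
        rw [← Finset.sum_add_distrib]
        refine Finset.sum_congr rfl fun s _ => ?_
        rw [BorelC.restrict_union hA hB hd, map_add, add_apply])
      (fun B hB => by
        rw [Finset.sum_mul]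
        exact (Finset.abs_sum_le_sum_abs _ _).trans (Finset.sum_le_sum fun s _ => hQ s B hB))
      hP hcov
      (fun j B hB hBP => hC ε hε1 (P j) j.2.2 (fun s i =>
        (lipschitzOnWith_closure_affineApproxSet hπ.continuous s i).mono Set.inter_subset_left)
        (fun x hx => hx.2) B hB hBP)
    simpa only [BorelC.restrict_univ] using key
  have hlim : Tendsto (fun n : ℕ => C * (1 / ((n : ℝ) + 1)) * m.real Set.univ) atTop (𝓝 0) := by
    simpa using (tendsto_one_div_add_atTop_nhds_zero_nat.const_mul C).mul_const (m.real Set.univ)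
  refine abs_nonpos_iff.1 (ge_of_tendsto' hlim fun n => ?_)
  have hpos : (0 : ℝ) < (n : ℝ) + 1 := by positivity
  have := main (1 / ((n : ℝ≥0) + 1)) (by positivity)
    (div_le_one_of_le₀ (le_add_of_nonneg_left zero_le) zero_le)
  simpa using this

end VanishingSet

theorem theorem1p1 {X : Type*} [MetricSpace X] [LocallyCompactSpace X]
    [TopologicalSpace.SeparableSpace X] [MeasurableSpace X] [BorelSpace X] (μ : Measure X)
    (hX : AdmitsStrongMeasuredDifferentiableStructure μ)
    {E : Type*} [NormedAddCommGroup E] [InnerProductSpace ℝ E] [FiniteDimensional ℝ E]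
    (Y : Set X) (π : Y → E) (hY : IsCoordinatePatch μ Y π)
    {k : ℕ} {S : Type*} [Fintype S] (β : S → X → ℝ) (hβ : ∀ s, IsBoundedBorelC (β s))
    (g : S → Fin k → LipLoc X)
    (T : MetricCurrent k X) (hT : T.HasLocallyFiniteMass)
    (hconc : T.IsConcentratedOn (cheegerVanishingSet π β g)) :
    ∃ t : S → ℝ, (∀ s, T.HasValue (β s) (g s) (t s)) ∧ ∑ s, t s = 0 := by
  let β' : S → BorelC X := fun s => ⟨β s, hβ s⟩
  exact ⟨fun s => T.borelExtension hT (β' s) (g s),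
    fun s => T.hasValue_borelExtension hT (β' s) (g s),
    T.sum_borelExtension_eq_zero hT hY.1 β' g hconc⟩
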